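/- **Conventions.** An étale groupoid $\mathcal G$ consists of topological spaces $\mathcal G$ (arrows) and $\mathcal G^0$ (objects), local homeomorphisms $r,s\colon\mathcal G\rightrightarrows\mathcal G^0$, and continuous multiplication (of pairs with $s(g)=r(h)$), unit and inversion maps satisfying the usual groupoid laws. No Hausdorff or local compactness assumption is made. Left and right actions of $\mathcal G$ on a space are continuous, have a continuous anchor map to $\mathcal G^0$, and are unital and associative. A right action on $X$ with anchor map $s$ is *basic* if $X\times_{s,\mathcal G^0,r}\mathcal G\to X\times X$, $(x,g)\mapsto(x\cdot g,x)$, is a homeomorphism onto its image. A *groupoid correspondence* $X\colon\mathcal H\leftarrow\mathcal G$ between étale groupoids is a space $X$ with commuting actions of $\mathcal H$ on the left (anchor map $r\colon X\to\mathcal H^0$) and of $\mathcal G$ on the right (anchor map $s\colon X\to\mathcal G^0$), such that $s$ is a local homeomorphism and the right action is basic. The composite $X\circ_{\mathcal H}Y$ of $X\colon\mathcal K\leftarrow\mathcal H$ and $Y\colon\mathcal H\leftarrow\mathcal G$ is the orbit space of $X\times_{s,\mathcal H^0,r}Y$ under the diagonal action $h\cdot(x,y)=(x h^{-1},h y)$,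 with the quotient topology and the induced actions of $\mathcal K$ and $\mathcal G$. Let $\mathcal C$ be a small category. A *diagram of groupoid correspondences* $F\colon\mathcal C\to\mathfrak{Gr}$ consists of étale groupoids $\mathcal G_x$ for the objects $x$ of $\mathcal C$, groupoid correspondences $X_g\colon\mathcal G_{x'}\leftarrow\mathcal G_{x}$ for the arrows $g\colon x'\leftarrow x$, biequivariant homeomorphisms $\mu_{g,h}\colon X_g\circ X_h\to X_{gh}$, $[\gamma,\delta]\mapsto\gamma\cdot\delta$, for composable $g,h$, and biequivariant homeomorphisms $\mathcal G_x\cong X_{1_x}$ for all objects $x$ (by which we identify them), such that the $\mu_{g,h}$ are associative, that is, $(\gamma_1\cdot\gamma_2)\cdot\gamma_3=\gamma_1\cdot(\gamma_2\cdot\gamma_3)$, and $\mu_{g,1}$ and $\mu_{1,g}$ are the canonical isomorphisms $[\gamma,\eta]\mapsto\gamma\cdot\eta$ and $[\eta,\gamma]\mapsto\eta\cdot\gamma$. An *$F$-action* on a topological space $Y$ consists of a partition $Y=\bigsqcup_{x\in\mathcal C^0}Y_x$ into (possibly empty) clopen subsets, continuous maps $r\colon Y_x\to\mathcal G_x^0$,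 and continuous, open, surjective maps $X_g\times_{s,\mathcal G_x^0,r}Y_x\to Y_{x'}$, $(\gamma,y)\mapsto\gamma\cdot y$, for all arrows $g\colon x'\leftarrow x$, such that 1. $r(\gamma\cdot y)=r(\gamma)$ and $\gamma_1\cdot(\gamma_2\cdot y)=(\gamma_1\cdot\gamma_2)\cdot y$ whenever these are defined; 2. if $\gamma\cdot y=\gamma'\cdot y'$ for $\gamma,\gamma'\in X_g$ and $y,y'\in Y_x$, then there is $\eta\in\mathcal G_x$ with $\gamma'=\gamma\cdot\eta$ and $y=\eta\cdot y'$. A map $\varphi\colon Y\to Y'$ between $F$-actions is *$F$-equivariant* if $\varphi(Y_x)\subseteq Y'_x$, $r(\varphi(y))=r(y)$ and $\varphi(\gamma\cdot y)=\gamma\cdot\varphi(y)$ whenever these are defined. An $F$-action $\Omega$ is *universal* if for every $F$-action $Y$ there is a unique continuous $F$-equivariant map $Y\to\Omega$, that is, if $\Omega$ is terminal in the category of $F$-actions. A *groupoid model* for $F$ is an étale groupoid $\mathcal U$ with bijections, for all topological spaces $Y$, between the set of left $\mathcal U$-actions on $Y$ and the set of $F$-actions on $Y$, which are natural in the sense that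 a continuous map $Y\to Y'$ between spaces with $\mathcal U$-actions is $\mathcal U$-equivariant if and only if it is $F$-equivariant for the corresponding $F$-actions. **Theorem.** Let $\mathcal C$ be a small category and let $F\colon\mathcal C\to\mathfrak{Gr}$ be any diagram of groupoid correspondences. Then $F$ has a universal $F$-action and a groupoid model. -/

import Mathlib

open CategoryTheory

universe u

/-- An étale topological groupoid: spaces of objects and arrows with local homeomorphisms
`r` (range) and `s` (source), and continuous unit, inversion and multiplication maps.  The product
`g * h` is defined if `s g = r h`.  No separation or local compactness is assumed. -/
structure EtaleGroupoid where
  Obj : Type u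
  Arr : Type u
  [topObj : TopologicalSpace Obj]
  [topArr : TopologicalSpace Arr]
  r : Arr → Obj
  s : Arr → Obj
  unit : Obj → Arr
  inv : Arr → Arr
  mul : (g h : Arr) → s g = r h → Arr
  r_unit : ∀ x, r (unit x) = x
  s_unit : ∀ x, s (unit x) = x
  r_inv : ∀ g, r (inv g) = s g
  s_inv : ∀ g, s (inv g) = r g
  r_mul : ∀ g h e, r (mul g h e) = r g
  s_mul : ∀ g h e, s (mul g h e) = s h
  unit_mul : ∀ g, mul (unit (r g)) g (s_unit _) = g
  mul_unit : ∀ g, mul g (unit (s g)) (r_unit _).symm = g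
  inv_mul : ∀ g, mul (inv g) g (s_inv g) = unit (s g)
  mul_inv : ∀ g, mul g (inv g) (r_inv g).symm = unit (r g)
  mul_assoc : ∀ g h k (e₁ : s g = r h) (e₂ : s h = r k),
    mul (mul g h e₁) k ((s_mul g h e₁).trans e₂) = mul g (mul h k e₂) (e₁.trans (r_mul h k e₂).symm)
  isLocalHomeomorph_r : IsLocalHomeomorph r
  isLocalHomeomorph_s : IsLocalHomeomorph s
  continuous_unit : Continuous unit
  continuous_inv : Continuous inv
  continuous_mul : Continuous fun p : {p : Arr × Arr // s p.1 = r p.2} => mul p.1.1 p.1.2 p.2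

attribute [instance] EtaleGroupoid.topObj EtaleGroupoid.topArr

/-- A continuous left action of an étale groupoid `G` on a space `X`. -/
@[ext]
structure EtaleGroupoid.LeftAction (G : EtaleGroupoid.{u}) (X : Type u) [TopologicalSpace X] where
  anchor : X → G.Obj
  act : (g : G.Arr) → (x : X) → G.s g = anchor x → X
  continuous_anchor : Continuous anchor
  continuous_act :
    Continuous fun p : {p : G.Arr × X // G.s p.1 = anchor p.2} => act p.1.1 p.1.2 p.2
  anchor_act : ∀ g x e, anchor (act g x e) = G.r g
  unit_act : ∀ x, act (G.unit (anchor x)) x (G.s_unit _) = x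
  act_act : ∀ g h x (e₁ : G.s g = G.r h) (e₂ : G.s h = anchor x),
    act g (act h x e₂) (e₁.trans (anchor_act h x e₂).symm) =
      act (G.mul g h e₁) x ((G.s_mul g h e₁).trans e₂)

/-- Equivariance of a map between two left `G`-spaces. -/
def EtaleGroupoid.LeftAction.IsEquivariant {G : EtaleGroupoid.{u}} {X X' : Type u}
    [TopologicalSpace X] [TopologicalSpace X'] (A : G.LeftAction X) (A' : G.LeftAction X')
    (φ : X → X') : Prop :=
  ∃ hφ : ∀ x, A'.anchor (φ x) = A.anchor x,
    ∀ g x (e : G.s g = A.anchor x), φ (A.act g x e) = A'.act g (φ x) (e.trans (hφ x).symm)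

/-- A continuous right action of an étale groupoid `G` on a space `X`. -/
@[ext]
structure EtaleGroupoid.RightAction (G : EtaleGroupoid.{u}) (X : Type u) [TopologicalSpace X] where
  anchor : X → G.Obj
  act : (x : X) → (g : G.Arr) → anchor x = G.r g → X
  continuous_anchor : Continuous anchor
  continuous_act :
    Continuous fun p : {p : X × G.Arr // anchor p.1 = G.r p.2} => act p.1.1 p.1.2 p.2
  anchor_act : ∀ x g e, anchor (act x g e) = G.s g
  act_unit : ∀ x, act x (G.unit (anchor x)) (G.r_unit _).symm = x
  act_act : ∀ x g h (e₁ : anchor x = G.r g) (e₂ : G.s g = G.r h),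
    act (act x g e₁) h ((anchor_act x g e₁).trans e₂) =
      act x (G.mul g h e₂) (e₁.trans (G.r_mul g h e₂).symm)

/-- A right action is basic if `(x, g) ↦ (x · g, x)` is a homeomorphism from the fibre product of
`X` and `G` onto its image in `X × X`. -/
def EtaleGroupoid.RightAction.IsBasic {G : EtaleGroupoid.{u}} {X : Type u} [TopologicalSpace X]
    (A : G.RightAction X) : Prop :=
  Topology.IsEmbedding fun p : {p : X × G.Arr // A.anchor p.1 = G.r p.2} =>
    (A.act p.1.1 p.1.2 p.2, p.1.1)

/-- A groupoid correspondence `H ← G`: a space with commuting actions of `H` on the left and `G` on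
the right, such that the right anchor map is a local homeomorphism and the right action is basic. -/
structure GroupoidCorrespondence (H G : EtaleGroupoid.{u}) where
  Carrier : Type u
  [top : TopologicalSpace Carrier]
  left : H.LeftAction Carrier
  right : G.RightAction Carrier
  right_anchor_left_act : ∀ h γ e, right.anchor (left.act h γ e) = right.anchor γ
  left_anchor_right_act : ∀ γ g e, left.anchor (right.act γ g e) = left.anchor γ
  act_comm : ∀ h γ g (e₁ : H.s h = left.anchor γ) (e₂ : right.anchor γ = G.r g),
    right.act (left.act h γ e₁) g ((right_anchor_left_act h γ e₁).trans e₂) =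
      left.act h (right.act γ g e₂) (e₁.trans (left_anchor_right_act γ g e₂).symm)
  isLocalHomeomorph_anchor : IsLocalHomeomorph right.anchor
  isBasic : right.IsBasic

attribute [instance] GroupoidCorrespondence.top

namespace GroupoidCorrespondence

variable {K H G : EtaleGroupoid.{u}}

/-- The fibre product of two correspondences `K ← H` and `H ← G` over `H.Obj`. -/
abbrev FibreProd (X : GroupoidCorrespondence K H) (Y : GroupoidCorrespondence H G) : Type u :=
  {p : X.Carrier × Y.Carrier // X.right.anchor p.1 = Y.left.anchor p.2}

/-- The orbit relation of the diagonal `H`-action `η · (γ, δ) = (γ · η⁻¹, η · δ)` on the fibre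
product: two pairs `(γ, δ)` and `(γ', δ')` are in the same orbit if and only if there is
`η` with `γ' = γ · η` and `δ = η · δ'`. -/
def compSetoid (X : GroupoidCorrespondence K H) (Y : GroupoidCorrespondence H G) :
    Setoid (FibreProd X Y) where
  r p q := ∃ (η : H.Arr) (e₁ : X.right.anchor p.1.1 = H.r η) (e₂ : H.s η = Y.left.anchor q.1.2),
    q.1.1 = X.right.act p.1.1 η e₁ ∧ p.1.2 = Y.left.act η q.1.2 e₂
  iseqv :=
    { refl := fun p => ⟨H.unit (X.right.anchor p.1.1), (H.r_unit _).symm,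
        (H.s_unit _).trans p.2, (X.right.act_unit _).symm, by
          have h := Y.left.unit_act p.1.2
          simp only [← p.2] at h
          exact h.symm⟩
      symm := by
        rintro ⟨⟨a, b⟩, hab⟩ ⟨⟨c, d⟩, hcd⟩ ⟨η, e₁, e₂, h₁, h₂⟩
        change X.right.anchor a = H.r η at e₁
        change H.s η = Y.left.anchor d at e₂
        change c = X.right.act a η e₁ at h₁
        change b = Y.left.act η d e₂ at h₂
        refine ⟨H.inv η, ?_, ?_, ?_, ?_⟩
        · change X.right.anchor c = _
          rw [h₁, X.right.anchor_act, H.r_inv]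
        · change _ = Y.left.anchor b
          rw [h₂, Y.left.anchor_act, H.s_inv]
        · have h := X.right.act_unit a
          have h' := X.right.act_act a η (H.inv η) e₁ (H.r_inv η).symm
          simp only [H.mul_inv, ← e₁, h] at h'
          simp only [h₁, h']
        · have h := Y.left.unit_act d
          have h' := Y.left.act_act (H.inv η) η d (H.s_inv η) e₂
          simp only [H.inv_mul, e₂, h] at h'
          simp only [h₂, h']
      trans := by
        rintro ⟨⟨a, b⟩, hab⟩ ⟨⟨c, d⟩, hcd⟩ ⟨⟨e, f⟩, hef⟩ ⟨η, e₁, e₂, h₁, h₂⟩ ⟨ζ, e₃, e₄, h₃, h₄⟩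
        change X.right.anchor a = H.r η at e₁
        change H.s η = Y.left.anchor d at e₂
        change c = X.right.act a η e₁ at h₁
        change b = Y.left.act η d e₂ at h₂
        change X.right.anchor c = H.r ζ at e₃
        change H.s ζ = Y.left.anchor f at e₄
        change e = X.right.act c ζ e₃ at h₃
        change d = Y.left.act ζ f e₄ at h₄
        have e₅ : H.s η = H.r ζ := by rw [e₂, h₄, Y.left.anchor_act]
        refine ⟨H.mul η ζ e₅, e₁.trans (H.r_mul _ _ _).symm, (H.s_mul _ _ _).trans e₄, ?_, ?_⟩
        · have h := X.right.act_act a η ζ e₁ e₅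
          simp only [h₃, h₁, h]
        · have h := Y.left.act_act η ζ f e₅ e₄
          simp only [h₂, h₄, h] }

/-- The underlying space of the composite correspondence: the orbit space of the fibre product by
the diagonal action, with the quotient topology. -/
abbrev Comp (X : GroupoidCorrespondence K H) (Y : GroupoidCorrespondence H G) : Type u :=
  Quotient (compSetoid X Y)

/-- The class `[γ, δ]` in the composite correspondence. -/
def Comp.mk {X : GroupoidCorrespondence K H} {Y : GroupoidCorrespondence H G}
    (γ : X.Carrier) (δ : Y.Carrier) (e : X.right.anchor γ = Y.left.anchor δ) : Comp X Y :=
  Quotient.mk (compSetoid X Y) ⟨(γ, δ), e⟩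

/-- An isomorphism of correspondences from the composite of `X` and `Y` to `Z`: a homeomorphism
that is compatible with the anchor maps and equivariant, where the actions on the composite are
`k · [γ, δ] = [k · γ, δ]` and `[γ, δ] · g = [γ, δ · g]`. -/
structure CompIso (X : GroupoidCorrespondence K H) (Y : GroupoidCorrespondence H G)
    (Z : GroupoidCorrespondence K G) where
  homeo : Comp X Y ≃ₜ Z.Carrier
  left_anchor : ∀ γ δ e, Z.left.anchor (homeo (Comp.mk γ δ e)) = X.left.anchor γ
  right_anchor : ∀ γ δ e, Z.right.anchor (homeo (Comp.mk γ δ e)) = Y.right.anchor δ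
  map_left_act : ∀ k γ δ (e : X.right.anchor γ = Y.left.anchor δ) (e' : K.s k = X.left.anchor γ),
    homeo (Comp.mk (X.left.act k γ e') δ ((X.right_anchor_left_act k γ e').trans e)) =
      Z.left.act k (homeo (Comp.mk γ δ e)) (e'.trans (left_anchor γ δ e).symm)
  map_right_act : ∀ γ δ g (e : X.right.anchor γ = Y.left.anchor δ)
      (e' : Y.right.anchor δ = G.r g),
    homeo (Comp.mk γ (Y.right.act δ g e') (e.trans (Y.left_anchor_right_act δ g e').symm)) =
      Z.right.act (homeo (Comp.mk γ δ e)) g ((right_anchor γ δ e).trans e')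

/-- The product `γ · δ ∈ Z`, that is, the image of `[γ, δ]`. -/
def CompIso.mul {X : GroupoidCorrespondence K H} {Y : GroupoidCorrespondence H G}
    {Z : GroupoidCorrespondence K G} (μ : CompIso X Y Z) (γ : X.Carrier) (δ : Y.Carrier)
    (e : X.right.anchor γ = Y.left.anchor δ) : Z.Carrier :=
  μ.homeo (Comp.mk γ δ e)

/-- An isomorphism of correspondences from the identity correspondence (the arrow space of `G` with
left and right multiplication) to `Z`. -/
structure UnitIso (Z : GroupoidCorrespondence G G) where
  homeo : G.Arr ≃ₜ Z.Carrier
  left_anchor : ∀ g, Z.left.anchor (homeo g) = G.r g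
  right_anchor : ∀ g, Z.right.anchor (homeo g) = G.s g
  map_left_act : ∀ g h (e : G.s g = G.r h),
    homeo (G.mul g h e) = Z.left.act g (homeo h) (e.trans (left_anchor h).symm)
  map_right_act : ∀ g h (e : G.s g = G.r h),
    homeo (G.mul g h e) = Z.right.act (homeo g) h ((right_anchor g).trans e)

end GroupoidCorrespondence

/-- A diagram of groupoid correspondences of shape `C`, that is, a homomorphism from the category
`C` to the bicategory of étale groupoid correspondences.  An arrow `g : x ⟶ y` is sent to a
correspondence `gr y ← gr x`.  The target `k` of `μ g h k _` is the composite arrow `h ≫ g`; it is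
kept as a variable so that associativity and unit laws in `C` need no transport. -/
structure GroupoidDiagram (C : Type u) [SmallCategory C] where
  gr : C → EtaleGroupoid.{u}
  corr : {x y : C} → (x ⟶ y) → GroupoidCorrespondence (gr y) (gr x)
  unitIso : (x : C) → (corr (𝟙 x)).UnitIso
  μ : {x y z : C} → (g : y ⟶ z) → (h : x ⟶ y) → (k : x ⟶ z) → h ≫ g = k →
    GroupoidCorrespondence.CompIso (corr g) (corr h) (corr k)
  /-- The isomorphisms for `g` and an identity arrow are the canonical ones,
  `[γ, η] ↦ γ · η` and `[η, γ] ↦ η · γ`. -/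
  μ_unit_right : ∀ {x y : C} (g : x ⟶ y) (γ : (corr g).Carrier) (η : (gr x).Arr)
    (e : (corr g).right.anchor γ = (gr x).r η),
    (μ g (𝟙 x) g (Category.id_comp g)).mul γ ((unitIso x).homeo η)
      (e.trans ((unitIso x).left_anchor η).symm) = (corr g).right.act γ η e
  μ_unit_left : ∀ {x y : C} (g : x ⟶ y) (η : (gr y).Arr) (γ : (corr g).Carrier)
    (e : (gr y).s η = (corr g).left.anchor γ),
    (μ (𝟙 y) g g (Category.comp_id g)).mul ((unitIso y).homeo η) γ
      (((unitIso y).right_anchor η).trans e) = (corr g).left.act η γ e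
  /-- Coherence with the associator: `(γ₁ · γ₂) · γ₃ = γ₁ · (γ₂ · γ₃)`. -/
  μ_assoc : ∀ {x₀ x₁ x₂ x₃ : C} (g₀₁ : x₁ ⟶ x₀) (g₁₂ : x₂ ⟶ x₁) (g₂₃ : x₃ ⟶ x₂)
    (g₀₂ : x₂ ⟶ x₀) (g₁₃ : x₃ ⟶ x₁) (g₀₃ : x₃ ⟶ x₀)
    (h₀₂ : g₁₂ ≫ g₀₁ = g₀₂) (h₁₃ : g₂₃ ≫ g₁₂ = g₁₃)
    (h₀₃ : g₂₃ ≫ g₀₂ = g₀₃) (h₀₃' : g₁₃ ≫ g₀₁ = g₀₃)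
    (γ₁ : (corr g₀₁).Carrier) (γ₂ : (corr g₁₂).Carrier) (γ₃ : (corr g₂₃).Carrier)
    (e₁ : (corr g₀₁).right.anchor γ₁ = (corr g₁₂).left.anchor γ₂)
    (e₂ : (corr g₁₂).right.anchor γ₂ = (corr g₂₃).left.anchor γ₃),
    (μ g₀₂ g₂₃ g₀₃ h₀₃).mul ((μ g₀₁ g₁₂ g₀₂ h₀₂).mul γ₁ γ₂ e₁) γ₃
        (((μ g₀₁ g₁₂ g₀₂ h₀₂).right_anchor γ₁ γ₂ e₁).trans e₂) =
      (μ g₀₁ g₁₃ g₀₃ h₀₃').mul γ₁ ((μ g₁₂ g₂₃ g₁₃ h₁₃).mul γ₂ γ₃ e₂)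
        (e₁.trans ((μ g₁₂ g₂₃ g₁₃ h₁₃).left_anchor γ₂ γ₃ e₂).symm)

namespace GroupoidDiagram

variable {C : Type u} [SmallCategory C]

/-- An action of the diagram `F` on a space `Y`: a partition of `Y` into clopen subsets `piece x`
for `x : C` (some of which may be empty), continuous anchor maps, and continuous, open, surjective
multiplication maps, subject to the algebraic conditions below. -/
@[ext]
structure Action (F : GroupoidDiagram C) (Y : Type u) [TopologicalSpace Y] where
  piece : C → Set Y
  anchor : (x : C) → piece x → (F.gr x).Obj
  act : {x x' : C} → (g : x ⟶ x') → (γ : (F.corr g).Carrier) → (y : piece x) →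
    (F.corr g).right.anchor γ = anchor x y → piece x'
  isClopen_piece : ∀ x, IsClopen (piece x)
  existsUnique_piece : ∀ y, ∃! x, y ∈ piece x
  continuous_anchor : ∀ x, Continuous (anchor x)
  continuous_act : ∀ {x x' : C} (g : x ⟶ x'), Continuous
    fun p : {p : (F.corr g).Carrier × piece x // (F.corr g).right.anchor p.1 = anchor x p.2} =>
      act g p.1.1 p.1.2 p.2
  isOpenMap_act : ∀ {x x' : C} (g : x ⟶ x'), IsOpenMap
    fun p : {p : (F.corr g).Carrier × piece x // (F.corr g).right.anchor p.1 = anchor x p.2} =>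
      act g p.1.1 p.1.2 p.2
  surjective_act : ∀ {x x' : C} (g : x ⟶ x'), Function.Surjective
    fun p : {p : (F.corr g).Carrier × piece x // (F.corr g).right.anchor p.1 = anchor x p.2} =>
      act g p.1.1 p.1.2 p.2
  anchor_act : ∀ {x x' : C} (g : x ⟶ x') (γ : (F.corr g).Carrier) (y : piece x)
    (e : (F.corr g).right.anchor γ = anchor x y),
    anchor x' (act g γ y e) = (F.corr g).left.anchor γ
  act_act : ∀ {x₀ x₁ x₂ : C} (g₁ : x₁ ⟶ x₀) (g₂ : x₂ ⟶ x₁) (γ₁ : (F.corr g₁).Carrier)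
    (γ₂ : (F.corr g₂).Carrier) (y : piece x₂)
    (e₁ : (F.corr g₁).right.anchor γ₁ = (F.corr g₂).left.anchor γ₂)
    (e₂ : (F.corr g₂).right.anchor γ₂ = anchor x₂ y),
    act g₁ γ₁ (act g₂ γ₂ y e₂) (e₁.trans (anchor_act g₂ γ₂ y e₂).symm) =
      act (g₂ ≫ g₁) ((F.μ g₁ g₂ (g₂ ≫ g₁) rfl).mul γ₁ γ₂ e₁) y
        (((F.μ g₁ g₂ (g₂ ≫ g₁) rfl).right_anchor γ₁ γ₂ e₁).trans e₂)
  /-- If `γ · y = γ' · y'`, then there is `η` with `γ' = γ · η` and `y = η · y'`.  Here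
  `gr x` acts on `piece x` as the identity correspondence `corr (𝟙 x)`. -/
  exists_of_act_eq : ∀ {x x' : C} (g : x ⟶ x') (γ γ' : (F.corr g).Carrier) (y y' : piece x)
    (e : (F.corr g).right.anchor γ = anchor x y) (e' : (F.corr g).right.anchor γ' = anchor x y'),
    act g γ y e = act g γ' y' e' →
      ∃ (η : (F.gr x).Arr) (h₁ : (F.corr g).right.anchor γ = (F.gr x).r η)
        (h₂ : (F.gr x).s η = anchor x y'),
        γ' = (F.corr g).right.act γ η h₁ ∧
        y = act (𝟙 x) ((F.unitIso x).homeo η) y' (((F.unitIso x).right_anchor η).trans h₂)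

/-- Equivariance of a map between two `F`-actions: it maps `piece x` to `piece x`, and is compatible
with the anchor maps and the multiplication maps. -/
def Action.IsEquivariant {F : GroupoidDiagram C} {Y Y' : Type u} [TopologicalSpace Y]
    [TopologicalSpace Y'] (A : F.Action Y) (A' : F.Action Y') (φ : Y → Y') : Prop :=
  ∃ (h₁ : ∀ (x : C) (y : A.piece x), φ y ∈ A'.piece x)
    (h₂ : ∀ (x : C) (y : A.piece x), A'.anchor x ⟨φ y, h₁ x y⟩ = A.anchor x y),
    ∀ {x x' : C} (g : x ⟶ x') (γ : (F.corr g).Carrier) (y : A.piece x)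
      (e : (F.corr g).right.anchor γ = A.anchor x y),
      φ (A.act g γ y e) = A'.act g γ ⟨φ y, h₁ x y⟩ (e.trans (h₂ x y).symm)

/-- An `F`-action is universal if every `F`-action has a unique continuous equivariant map to it. -/
def Action.IsUniversal {F : GroupoidDiagram C} {Ω : Type u} [TopologicalSpace Ω]
    (A : F.Action Ω) : Prop :=
  ∀ (Y : Type u) [TopologicalSpace Y] (B : F.Action Y), ∃! φ : C(Y, Ω), B.IsEquivariant A φ

/-- A groupoid model for `F`-actions: an étale groupoid with bijections, for all spaces `Y`, between
its actions on `Y` and the `F`-actions on `Y`.  Naturality says that these bijections preserve and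
reflect equivariance of continuous maps. -/
structure GroupoidModel (F : GroupoidDiagram C) where
  gpd : EtaleGroupoid.{u}
  equiv : (Y : Type u) → [TopologicalSpace Y] → gpd.LeftAction Y ≃ F.Action Y
  natural : ∀ (Y Y' : Type u) [TopologicalSpace Y] [TopologicalSpace Y']
    (A : gpd.LeftAction Y) (A' : gpd.LeftAction Y') (φ : C(Y, Y')),
    A.IsEquivariant A' φ ↔ (equiv Y A).IsEquivariant (equiv Y' A') φ

end GroupoidDiagram

open Topology Set

/-! ### Preliminaries on étale groupoids and fibre products -/

namespace EtaleGroupoid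

variable (G : EtaleGroupoid.{u})

/-! Call a subset of a correspondence `X_g` a slice if the right anchor map and the orbit projection
are injective on it. In every `F`-action a slice acts by a partial bijection, and so does its
inverse; words in these letters act by composition. The behaviour of a point is the set of words
defined at it. The letters form a type in the universe `u`, so the behaviours of points in all
`F`-actions form a type `Ω` in `u`, although there is a proper class of `F`-actions.

Behaviours are exactly what equivariant maps preserve. An equivariant map carries words forward and
also lifts them (`exists_mulRel_left`, `exists_mulRel_right`), so behaviour is invariant.
Conversely, single elements are slices, so the behaviour of `y` determines its piece, its anchor and
the behaviours of `γ · y` and of any solution `v` of `γ · v = y`. Hence the structure of an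
`F`-action descends to `Ω`. With the final topology for the canonical maps `Y → Ω`, its topological
axioms hold because open slices act by partial homeomorphisms and cover the correspondences.
Openness of the units and basicness of the right action provide enough open slices. A point of `Ω`
has itself as behaviour, so an equivariant map to `Ω` must be the canonical one.

The groupoid model has object space `Ω` and arrows the germs of words in open slices. Germs must be
compared in all `F`-actions over a neighbourhood in `Ω`, not just on `Ω`: for a discrete group
viewed as a diagram on the trivial category, `Ω` is a point, but the model has to be the group.

Germs act on every `F`-action by applying words. Conversely, given an action of the model, `γ · y`
is the germ of multiplication by `γ` applied to `y`; `mul_ofMul` says that these germs multiply like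
the elements of the correspondences. The two constructions preserve equivariance and are mutually
inverse, because in the `F`-action built from a model action each open word acts through its own
germs (`modelRel_of_wordRel`). -/

theorem isOpenMap_unit : IsOpenMap G.unit := by
  have h : IsLocalHomeomorph (G.s ∘ G.unit) := by
    rw [show G.s ∘ G.unit = id from funext G.s_unit]
    exact (Homeomorph.refl _).isLocalHomeomorph
  exact (IsLocalHomeomorph.of_comp h G.isLocalHomeomorph_s G.continuous_unit).isOpenMap

variable {G}

theorem LeftAction.act_congr {X : Type u} [TopologicalSpace X] (A : G.LeftAction X) {x x' : X}
    {g g' : G.Arr} (hg : g = g') (hx : x = x') (e : G.s g = A.anchor x) :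
    A.act g x e = A.act g' x' (hx ▸ hg ▸ e) := by
  subst hx hg; rfl

end EtaleGroupoid

/-- If `s` is an open map, then so is the projection `X ×_B Z → Z`. -/
theorem isOpen_setOf_exists_fibreProd {X Z B : Type*} [TopologicalSpace X] [TopologicalSpace Z]
    [TopologicalSpace B] {s : X → B} (hs : IsOpenMap s) {r : Z → B} (hr : Continuous r)
    {T : Set {p : X × Z // s p.1 = r p.2}} (hT : IsOpen T) :
    IsOpen {z | ∃ γ e, (⟨(γ, z), e⟩ : {p : X × Z // s p.1 = r p.2}) ∈ T} := by
  obtain ⟨O, hO, rfl⟩ := isOpen_induced_iff.1 hT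
  rw [isOpen_iff_forall_mem_open]
  rintro z ⟨γ, e, h⟩
  obtain ⟨A, B', hA, hB, hγ, hz, hAB⟩ := isOpen_prod_iff.1 hO γ z h
  refine ⟨B' ∩ r ⁻¹' (s '' A), ?_, hB.inter ((hs _ hA).preimage hr), hz, γ, hγ, e⟩
  rintro z' ⟨hz', γ', hγ', e'⟩
  exact ⟨γ', e', hAB ⟨hγ', hz'⟩⟩

/-! ### Slices of a groupoid correspondence -/

namespace GroupoidCorrespondence

variable {K H G : EtaleGroupoid.{u}}

/-- A slice of a correspondence: a subset on which the right anchor map and the orbit space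
projection of the right action are injective. -/
def IsSlice (X : GroupoidCorrespondence H G) (S : Set X.Carrier) : Prop :=
  InjOn X.right.anchor S ∧
    ∀ γ ∈ S, ∀ η e, X.right.act γ η e ∈ S → X.right.act γ η e = γ

variable {X : GroupoidCorrespondence H G}

/-- Freeness of the right action, which is the injectivity part of basicness. -/
theorem eq_unit_of_act_eq {γ : X.Carrier} {η : G.Arr} {e : X.right.anchor γ = G.r η}
    (h : X.right.act γ η e = γ) : η = G.unit (X.right.anchor γ) := by
  have := @X.isBasic.injective ⟨(γ, η), e⟩ ⟨(γ, G.unit (X.right.anchor γ)), (G.r_unit _).symm⟩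
    (by simp only [h, X.right.act_unit])
  simpa using congrArg (fun p => p.1.2) this

/-- Units are open in `G`, so by basicness the pairs `(γ · η, γ)` with `η` a unit are cut out of the
image in `X × X` by an open set `O`. This contains `(γ, γ)`, hence a box around it; if `δ` and `δ ·
η` both lie in the intersection of the two sides of the box, then `η` is a unit. Shrinking further
makes the anchor map injective. -/
theorem exists_isSlice_subset {γ : X.Carrier} {A : Set X.Carrier} (hA : A ∈ 𝓝 γ) :
    ∃ S ⊆ A, IsOpen S ∧ γ ∈ S ∧ X.IsSlice S := by
  obtain ⟨e, he, hse⟩ := X.isLocalHomeomorph_anchor γ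
  have hU : IsOpen {p : {p : X.Carrier × G.Arr // X.right.anchor p.1 = G.r p.2} |
      p.1.2 ∈ range G.unit} :=
    G.isOpenMap_unit.isOpen_range.preimage (continuous_snd.comp continuous_subtype_val)
  obtain ⟨O, hO, hOU⟩ := (X.isBasic.isInducing.isOpen_iff).1 hU
  have hmem : ∀ p : {p : X.Carrier × G.Arr // X.right.anchor p.1 = G.r p.2},
      (X.right.act p.1.1 p.1.2 p.2, p.1.1) ∈ O ↔ p.1.2 ∈ range G.unit := fun p => by
    have := congrArg (fun T => p ∈ T) hOU
    simpa using this
  have hγ : (γ, γ) ∈ O := by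
    have := (hmem ⟨(γ, G.unit (X.right.anchor γ)), (G.r_unit _).symm⟩).2 ⟨_, rfl⟩
    simpa only [X.right.act_unit] using this
  obtain ⟨S₁, S₂, h₁, h₂, hγ₁, hγ₂, hS⟩ := isOpen_prod_iff.1 hO γ γ hγ
  obtain ⟨A', hA', hA'o, hγA⟩ := mem_nhds_iff.1 hA
  refine ⟨A' ∩ (e.source ∩ (S₁ ∩ S₂)), fun _ h => hA' h.1,
    hA'o.inter (e.open_source.inter (h₁.inter h₂)), ⟨hγA, he, hγ₁, hγ₂⟩, ?_, ?_⟩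
  · rw [hse]
    exact e.injOn.mono fun _ h => h.2.1
  · rintro δ hδ η hη hδη
    obtain ⟨v, rfl⟩ := (hmem ⟨(δ, η), hη⟩).1 (hS ⟨hδη.2.2.1, hδ.2.2.2⟩)
    have hv : v = X.right.anchor δ := by rw [hη, G.r_unit]
    subst hv
    exact X.right.act_unit δ

theorem exists_isSlice (γ : X.Carrier) : ∃ S, IsOpen S ∧ γ ∈ S ∧ X.IsSlice S :=
  let ⟨S, _, h⟩ := exists_isSlice_subset (γ := γ) Filter.univ_mem
  ⟨S, h⟩

theorem isSlice_singleton (γ : X.Carrier) : X.IsSlice {γ} :=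
  ⟨injOn_singleton _ _, by rintro _ rfl η e h; exact h⟩

/-- Continuity of a map on a fibre product may be tested on slices. -/
theorem continuous_of_isSlice {Z Y : Type*} [TopologicalSpace Z] [TopologicalSpace Y]
    {r : Z → G.Obj} {f : {p : X.Carrier × Z // X.right.anchor p.1 = r p.2} → Y}
    (hf : ∀ S, IsOpen S → X.IsSlice S → ∀ W, IsOpen W →
      IsOpen {z | ∃ γ ∈ S, ∃ e, f ⟨(γ, z), e⟩ ∈ W}) : Continuous f := by
  rw [continuous_def]
  intro W hW
  rw [isOpen_iff_forall_mem_open]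
  rintro ⟨⟨γ, z⟩, e⟩ h
  obtain ⟨S, hSo, hγ, hS⟩ := exists_isSlice γ
  refine ⟨{p | p.1.1 ∈ S ∧ p.1.2 ∈ {z | ∃ γ ∈ S, ∃ e, f ⟨(γ, z), e⟩ ∈ W}}, ?_, ?_,
    hγ, γ, hγ, e, h⟩
  · rintro ⟨⟨γ', z'⟩, e'⟩ ⟨hγ', δ, hδ, e'', h'⟩
    -- A slice has at most one element over the anchor of `z'`, so the element found for `z'` is the
    -- first coordinate already given.
    obtain rfl := hS.1 hγ' hδ (e'.trans e''.symm)
    exact h'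
  · exact (hSo.preimage (continuous_fst.comp continuous_subtype_val)).inter
      ((hf S hSo hS W hW).preimage (continuous_snd.comp continuous_subtype_val))

/-- Openness of a map on a fibre product may be tested on slices. -/
theorem isOpenMap_of_isSlice {Z Y : Type*} [TopologicalSpace Z] [TopologicalSpace Y]
    {r : Z → G.Obj} {f : {p : X.Carrier × Z // X.right.anchor p.1 = r p.2} → Y}
    (hf : ∀ S, IsOpen S → X.IsSlice S → ∀ V, IsOpen V →
      IsOpen {y | ∃ γ ∈ S, ∃ z ∈ V, ∃ e, f ⟨(γ, z), e⟩ = y}) : IsOpenMap f := by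
  intro T hT
  obtain ⟨O, hO, rfl⟩ := isOpen_induced_iff.1 hT
  rw [isOpen_iff_forall_mem_open]
  rintro _ ⟨⟨⟨γ, z⟩, e⟩, h, rfl⟩
  obtain ⟨A, V, hA, hV, hγ, hz, hAV⟩ := isOpen_prod_iff.1 hO γ z h
  obtain ⟨S, hSA, hSo, hγS, hS⟩ := exists_isSlice_subset (hA.mem_nhds hγ)
  refine ⟨_, ?_, hf S hSo hS V hV, γ, hγS, z, hz, e, rfl⟩
  rintro _ ⟨δ, hδ, z', hz', e', rfl⟩
  exact ⟨⟨(δ, z'), e'⟩, hAV ⟨hSA hδ, hz'⟩, rfl⟩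

theorem CompIso.continuous_mul {X : GroupoidCorrespondence K H} {Y : GroupoidCorrespondence H G}
    {Z : GroupoidCorrespondence K G} (μ : CompIso X Y Z) :
    Continuous fun p : FibreProd X Y => μ.mul p.1.1 p.1.2 p.2 :=
  μ.homeo.continuous.comp continuous_quotient_mk'

end GroupoidCorrespondence

/-! ### Algebra in a single `F`-action and lifting along equivariant maps -/

namespace GroupoidDiagram

variable {C : Type u} [SmallCategory C] {F : GroupoidDiagram C}

namespace Action

variable {Y Y' : Type u} [TopologicalSpace Y] [TopologicalSpace Y'] (A : F.Action Y)
  {A' : F.Action Y'}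

theorem act_congr {x x' : C} (g : x ⟶ x') {γ γ' : (F.corr g).Carrier} {y y' : A.piece x}
    (hγ : γ = γ') (hy : y = y') (e : (F.corr g).right.anchor γ = A.anchor x y) :
    A.act g γ y e = A.act g γ' y' (hγ ▸ hy ▸ e) := by
  subst hγ hy; rfl

theorem piece_unique {x x' : C} {y : Y} (h : y ∈ A.piece x) (h' : y ∈ A.piece x') : x = x' :=
  (A.existsUnique_piece y).unique h h'

theorem act_act_of_eq {x₀ x₁ x₂ : C} (g₁ : x₁ ⟶ x₀) (g₂ : x₂ ⟶ x₁) (k : x₂ ⟶ x₀)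
    (hk : g₂ ≫ g₁ = k) (γ₁ : (F.corr g₁).Carrier)
    (γ₂ : (F.corr g₂).Carrier) (y : A.piece x₂)
    (e₁ : (F.corr g₁).right.anchor γ₁ = (F.corr g₂).left.anchor γ₂)
    (e₂ : (F.corr g₂).right.anchor γ₂ = A.anchor x₂ y) :
    A.act g₁ γ₁ (A.act g₂ γ₂ y e₂) (e₁.trans (A.anchor_act g₂ γ₂ y e₂).symm) =
      A.act k ((F.μ g₁ g₂ k hk).mul γ₁ γ₂ e₁) y
        (((F.μ g₁ g₂ k hk).right_anchor γ₁ γ₂ e₁).trans e₂) := by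
  subst hk
  exact A.act_act g₁ g₂ γ₁ γ₂ y e₁ e₂

theorem act_right_act {x x' : C} (g : x ⟶ x') (γ : (F.corr g).Carrier) (η : (F.gr x).Arr)
    (y : A.piece x) (e₁ : (F.corr g).right.anchor γ = (F.gr x).r η)
    (e₂ : (F.gr x).s η = A.anchor x y) :
    A.act g ((F.corr g).right.act γ η e₁) y (((F.corr g).right.anchor_act γ η e₁).trans e₂) =
      A.act g γ (A.act (𝟙 x) ((F.unitIso x).homeo η) y (((F.unitIso x).right_anchor η).trans e₂))
        (e₁.trans (((F.unitIso x).left_anchor η).symm.trans (A.anchor_act _ _ _ _).symm)) := by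
  rw [A.act_act_of_eq g (𝟙 x) g (Category.id_comp g) _ _ _
    (e₁.trans ((F.unitIso x).left_anchor η).symm)]
  exact A.act_congr g (F.μ_unit_right g γ η e₁).symm rfl _

/-- Not an axiom of `F`-actions: surjectivity of multiplication gives `y = γ · y'`, and the unit is
absorbed into `γ` by the left unit law of the diagram. -/
theorem unit_act {x : C} (y : A.piece x) :
    A.act (𝟙 x) ((F.unitIso x).homeo ((F.gr x).unit (A.anchor x y))) y
      (((F.unitIso x).right_anchor _).trans ((F.gr x).s_unit _)) = y := by
  obtain ⟨⟨⟨γ, y'⟩, e⟩, rfl⟩ := A.surjective_act (𝟙 x) y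
  have hl : A.anchor x (A.act (𝟙 x) γ y' e) = (F.corr (𝟙 x)).left.anchor γ := A.anchor_act _ _ _ _
  have e₁ : (F.gr x).s ((F.gr x).unit (A.anchor x (A.act (𝟙 x) γ y' e))) =
      (F.corr (𝟙 x)).left.anchor γ := ((F.gr x).s_unit _).trans hl
  rw [A.act_act_of_eq (𝟙 x) (𝟙 x) (𝟙 x) (Category.comp_id _) _ _ _
    (((F.unitIso x).right_anchor _).trans e₁)]
  refine A.act_congr _ ?_ rfl _
  refine (F.μ_unit_left (𝟙 x) _ γ e₁).trans ?_
  rw [EtaleGroupoid.LeftAction.act_congr _ (congrArg _ hl) rfl]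
  exact (F.corr (𝟙 x)).left.unit_act γ

/-- The second condition on `F`-actions with `γ = γ'` gives `η` with `γ = γ · η`; freeness makes `η`
a unit, and units act trivially. -/
theorem act_injective {x x' : C} (g : x ⟶ x') (γ : (F.corr g).Carrier) (y y' : A.piece x)
    (e : (F.corr g).right.anchor γ = A.anchor x y) (e' : (F.corr g).right.anchor γ = A.anchor x y')
    (h : A.act g γ y e = A.act g γ y' e') : y = y' := by
  obtain ⟨η, h₁, h₂, hγ, rfl⟩ := A.exists_of_act_eq g γ γ y y' e e' h
  have hη := GroupoidCorrespondence.eq_unit_of_act_eq hγ.symm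
  rw [e'] at hη
  subst hη
  exact A.unit_act y'

/-- The relation `γ · y = z`. -/
def MulRel {x x' : C} (g : x ⟶ x') (γ : (F.corr g).Carrier) (y z : Y) : Prop :=
  ∃ (hy : y ∈ A.piece x) (e : (F.corr g).right.anchor γ = A.anchor x ⟨y, hy⟩),
    (A.act g γ ⟨y, hy⟩ e : Y) = z

variable {A}

theorem MulRel.mem {x x' : C} {g : x ⟶ x'} {γ : (F.corr g).Carrier} {y z : Y}
    (h : A.MulRel g γ y z) : z ∈ A.piece x' := by
  obtain ⟨hy, e, rfl⟩ := h
  exact Subtype.coe_prop _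

theorem MulRel.right_unique {x x' : C} {g : x ⟶ x'} {γ : (F.corr g).Carrier} {y z z' : Y}
    (h : A.MulRel g γ y z) (h' : A.MulRel g γ y z') : z = z' := by
  obtain ⟨hy, e, rfl⟩ := h
  obtain ⟨hy, e, rfl⟩ := h'
  rfl

theorem MulRel.exists_of_eq {x x' : C} {g : x ⟶ x'} {γ γ' : (F.corr g).Carrier} {y y' z : Y}
    (h : A.MulRel g γ y z) (h' : A.MulRel g γ' y' z) :
    ∃ (η : (F.gr x).Arr) (e : (F.corr g).right.anchor γ = (F.gr x).r η),
      γ' = (F.corr g).right.act γ η e ∧ A.MulRel (𝟙 x) ((F.unitIso x).homeo η) y' y := by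
  obtain ⟨hy, e, rfl⟩ := h
  obtain ⟨hy', e', h⟩ := h'
  obtain ⟨η, h₁, h₂, h₃, h₄⟩ := A.exists_of_act_eq g γ γ' _ _ e e' (Subtype.ext h.symm)
  exact ⟨η, h₁, h₃, hy', _, (congrArg Subtype.val h₄).symm⟩

theorem MulRel.left_unique {x x' : C} {g : x ⟶ x'} {γ : (F.corr g).Carrier} {y y' z : Y}
    (h : A.MulRel g γ y z) (h' : A.MulRel g γ y' z) : y = y' := by
  obtain ⟨hy, e, rfl⟩ := h
  obtain ⟨hy', e', h⟩ := h'
  exact congrArg Subtype.val (A.act_injective g γ _ _ e e' (Subtype.ext h.symm))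

theorem MulRel.comp {x₀ x₁ x₂ : C} {g₁ : x₁ ⟶ x₀} {g₂ : x₂ ⟶ x₁} {k : x₂ ⟶ x₀}
    (hk : g₂ ≫ g₁ = k) {γ₁ : (F.corr g₁).Carrier} {γ₂ : (F.corr g₂).Carrier} {y z w : Y}
    (e : (F.corr g₁).right.anchor γ₁ = (F.corr g₂).left.anchor γ₂)
    (h₂ : A.MulRel g₂ γ₂ y z) (h₁ : A.MulRel g₁ γ₁ z w) :
    A.MulRel k ((F.μ g₁ g₂ k hk).mul γ₁ γ₂ e) y w := by
  obtain ⟨hy, e₂, rfl⟩ := h₂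
  obtain ⟨_, e₁, rfl⟩ := h₁
  exact ⟨hy, _, congrArg Subtype.val (A.act_act_of_eq g₁ g₂ k hk γ₁ γ₂ _ e e₂).symm⟩

theorem MulRel.unit {x : C} {y : Y} (hy : y ∈ A.piece x) :
    A.MulRel (𝟙 x) ((F.unitIso x).homeo ((F.gr x).unit (A.anchor x ⟨y, hy⟩))) y y :=
  ⟨hy, _, congrArg Subtype.val (A.unit_act ⟨y, hy⟩)⟩

theorem exists_mulRel {x x' : C} (g : x ⟶ x') {z : Y} (hz : z ∈ A.piece x') :
    ∃ γ y, A.MulRel g γ y z := by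
  obtain ⟨⟨⟨γ, y⟩, e⟩, h⟩ := A.surjective_act g ⟨z, hz⟩
  exact ⟨γ, y, y.2, e, congrArg Subtype.val h⟩

theorem IsEquivariant.mulRel {φ : Y → Y'} (hφ : A.IsEquivariant A' φ) {x x' : C} {g : x ⟶ x'}
    {γ : (F.corr g).Carrier} {y z : Y} (h : A.MulRel g γ y z) : A'.MulRel g γ (φ y) (φ z) := by
  obtain ⟨hy, e, rfl⟩ := h
  obtain ⟨h₁, h₂, h₃⟩ := hφ
  exact ⟨h₁ x ⟨y, hy⟩, e.trans (h₂ x ⟨y, hy⟩).symm, (h₃ g γ ⟨y, hy⟩ e).symm⟩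

theorem IsEquivariant.mem_piece_iff {φ : Y → Y'} (hφ : A.IsEquivariant A' φ) {x : C} {y : Y} :
    φ y ∈ A'.piece x ↔ y ∈ A.piece x := by
  refine ⟨fun h => ?_, fun h => hφ.1 x ⟨y, h⟩⟩
  obtain ⟨x', hx', -⟩ := A.existsUnique_piece y
  obtain rfl := A'.piece_unique h (hφ.1 x' ⟨y, hx'⟩)
  exact hx'

theorem IsEquivariant.exists_mulRel_right {φ : Y → Y'} (hφ : A.IsEquivariant A' φ) {x x' : C}
    {g : x ⟶ x'} {γ : (F.corr g).Carrier} {y : Y} {z' : Y'} (h : A'.MulRel g γ (φ y) z') :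
    ∃ z, A.MulRel g γ y z ∧ φ z = z' := by
  have hy : y ∈ A.piece x := hφ.mem_piece_iff.1 h.1
  have h' : A.MulRel g γ y (A.act g γ ⟨y, hy⟩ (h.2.1.trans (hφ.2.1 x ⟨y, hy⟩))) := ⟨hy, _, rfl⟩
  exact ⟨_, h', (hφ.mulRel h').right_unique h⟩

theorem MulRel.of_right_act {x x' : C} {g : x ⟶ x'} {γ : (F.corr g).Carrier} {η : (F.gr x).Arr}
    {e : (F.corr g).right.anchor γ = (F.gr x).r η} {y y' z : Y}
    (h : A.MulRel g ((F.corr g).right.act γ η e) y z)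
    (h' : A.MulRel (𝟙 x) ((F.unitIso x).homeo η) y y') : A.MulRel g γ y' z := by
  obtain ⟨hy, e₁, rfl⟩ := h
  obtain ⟨_, e₂, rfl⟩ := h'
  exact ⟨Subtype.coe_prop _, _, congrArg Subtype.val
    (A.act_right_act g γ η ⟨y, hy⟩ e (((F.unitIso x).right_anchor η).symm.trans e₂)).symm⟩

/-- Surjectivity upstairs gives some `z = δ · y`. Comparing `γ · y' = δ · φ y` downstairs yields `η`
with `δ = γ · η` and `η · φ y = y'`, so `η · y` is the desired lift of `y'`. -/
theorem IsEquivariant.exists_mulRel_left {φ : Y → Y'} (hφ : A.IsEquivariant A' φ) {x x' : C}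
    {g : x ⟶ x'} {γ : (F.corr g).Carrier} {y' : Y'} {z : Y} (h : A'.MulRel g γ y' (φ z)) :
    ∃ y, A.MulRel g γ y z ∧ φ y = y' := by
  obtain ⟨δ, y, hy⟩ := A.exists_mulRel g (hφ.mem_piece_iff.1 h.mem)
  obtain ⟨η, e, rfl, h'⟩ := h.exists_of_eq (hφ.mulRel hy)
  obtain ⟨w, hw, rfl⟩ := hφ.exists_mulRel_right h'
  exact ⟨w, hy.of_right_act hw, rfl⟩

end Action

/-! ### Words in slices and their partial bijections -/

/-- A letter is a slice of one of the correspondences in the diagram, together with a direction. It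
acts on any `F`-action by a partial bijection: multiplication by the slice or its inverse. -/
structure Letter (F : GroupoidDiagram C) where
  {dom cod : C}
  hom : dom ⟶ cod
  slice : Set (F.corr hom).Carrier
  isSlice : (F.corr hom).IsSlice slice
  forward : Bool

/-- The same slice in the opposite direction. -/
def Letter.flip (l : F.Letter) : F.Letter := { l with forward := !l.forward }

/-- The letter that acts by multiplication by a single arrow. -/
def Letter.point {x x' : C} (g : x ⟶ x') (γ : (F.corr g).Carrier) : F.Letter :=
  ⟨g, {γ}, GroupoidCorrespondence.isSlice_singleton γ, true⟩

/-- The formal inverse of a word. -/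
def wordInv (w : List F.Letter) : List F.Letter := (w.map Letter.flip).reverse

namespace Action

variable {Y Y' : Type u} [TopologicalSpace Y] [TopologicalSpace Y'] (A : F.Action Y)
  {A' : F.Action Y'}

/-- The graph of the partial bijection by which a slice acts. -/
def SliceRel {x x' : C} (g : x ⟶ x') (S : Set (F.corr g).Carrier) (y z : Y) : Prop :=
  ∃ γ ∈ S, A.MulRel g γ y z

/-- The graph of the partial bijection by which a letter acts. -/
def LetterRel (l : F.Letter) (y z : Y) : Prop :=
  bif l.forward then A.SliceRel l.hom l.slice y z else A.SliceRel l.hom l.slice z y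

/-- The graph of the partial bijection by which a word acts; the first letter acts first. -/
def WordRel : List F.Letter → Y → Y → Prop
  | [], y, z => y = z
  | l :: w, y, z => ∃ v, A.LetterRel l y v ∧ WordRel w v z

variable {A}

theorem SliceRel.right_unique {x x' : C} {g : x ⟶ x'} {S : Set (F.corr g).Carrier}
    (hS : (F.corr g).IsSlice S) {y z z' : Y} (h : A.SliceRel g S y z) (h' : A.SliceRel g S y z') :
    z = z' := by
  obtain ⟨γ, hγ, h⟩ := h
  obtain ⟨γ', hγ', h'⟩ := h'
  obtain rfl := hS.1 hγ hγ' (h.2.1.trans h'.2.1.symm)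
  exact h.right_unique h'

/-- If `γ · y = γ' · y'`, then `γ'` is in the right orbit of `γ`, and the second slice condition
forces `γ' = γ`. -/
theorem SliceRel.left_unique {x x' : C} {g : x ⟶ x'} {S : Set (F.corr g).Carrier}
    (hS : (F.corr g).IsSlice S) {y y' z : Y} (h : A.SliceRel g S y z) (h' : A.SliceRel g S y' z) :
    y = y' := by
  obtain ⟨γ, hγ, h⟩ := h
  obtain ⟨γ', hγ', h'⟩ := h'
  obtain ⟨η, e, rfl, h''⟩ := h.exists_of_eq h'
  rw [hS.2 γ hγ η e hγ'] at h'
  exact h.left_unique h'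

theorem isOpen_setOf_sliceRel_right {x x' : C} (g : x ⟶ x') {S : Set (F.corr g).Carrier}
    (hS : IsOpen S) {V : Set Y} (hV : IsOpen V) : IsOpen {z | ∃ y ∈ V, A.SliceRel g S y z} := by
  have h := (A.isClopen_piece x').isOpen.isOpenMap_subtype_val _ (A.isOpenMap_act g
    {p | p.1.1 ∈ S ∧ (p.1.2 : Y) ∈ V}
    ((hS.preimage (continuous_fst.comp continuous_subtype_val)).inter
      (hV.preimage (continuous_subtype_val.comp (continuous_snd.comp continuous_subtype_val)))))
  convert h using 1
  ext z
  constructor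
  · rintro ⟨y, hyV, γ, hγ, hy, e, rfl⟩
    exact ⟨_, ⟨⟨(γ, ⟨y, hy⟩), e⟩, ⟨hγ, hyV⟩, rfl⟩, rfl⟩
  · rintro ⟨_, ⟨⟨⟨γ, y⟩, e⟩, ⟨hγ, hyV⟩, rfl⟩, rfl⟩
    exact ⟨y, hyV, γ, hγ, y.2, e, rfl⟩

/-- Multiplication is continuous, and projecting its open preimage to `Y` is open because the right
anchor map of the correspondence is open. Together with the previous lemma, open slices act by
partial homeomorphisms. -/
theorem isOpen_setOf_sliceRel_left {x x' : C} (g : x ⟶ x') {S : Set (F.corr g).Carrier}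
    (hS : IsOpen S) {V : Set Y} (hV : IsOpen V) : IsOpen {y | ∃ z ∈ V, A.SliceRel g S y z} := by
  have h := (A.isClopen_piece x).isOpen.isOpenMap_subtype_val _
    (isOpen_setOf_exists_fibreProd (F.corr g).isLocalHomeomorph_anchor.isOpenMap
      (A.continuous_anchor x) (T := {p | p.1.1 ∈ S ∧ (A.act g p.1.1 p.1.2 p.2 : Y) ∈ V})
    ((hS.preimage (continuous_fst.comp continuous_subtype_val)).inter
      (hV.preimage (continuous_subtype_val.comp (A.continuous_act g)))))
  convert h using 1
  ext y
  constructor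
  · rintro ⟨_, hzV, γ, hγ, hy, e, rfl⟩
    exact ⟨⟨y, hy⟩, ⟨γ, e, hγ, hzV⟩, rfl⟩
  · rintro ⟨y, ⟨γ, e, hγ, hV⟩, rfl⟩
    exact ⟨_, hV, γ, hγ, y.2, e, rfl⟩

theorem letterRel_flip {l : F.Letter} {y z : Y} : A.LetterRel l.flip y z ↔ A.LetterRel l z y := by
  obtain ⟨g, S, hS, _ | _⟩ := l <;> rfl

theorem LetterRel.right_unique {l : F.Letter} {y z z' : Y} (h : A.LetterRel l y z)
    (h' : A.LetterRel l y z') : z = z' := by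
  obtain ⟨g, S, hS, _ | _⟩ := l
  · exact SliceRel.left_unique hS h h'
  · exact SliceRel.right_unique hS h h'

theorem isOpen_setOf_letterRel {l : F.Letter} (hl : IsOpen l.slice) {V : Set Y} (hV : IsOpen V) :
    IsOpen {y | ∃ z ∈ V, A.LetterRel l y z} := by
  obtain ⟨g, S, hS, _ | _⟩ := l
  · exact isOpen_setOf_sliceRel_right g hl hV
  · exact isOpen_setOf_sliceRel_left g hl hV

theorem letterRel_point {x x' : C} {g : x ⟶ x'} {γ : (F.corr g).Carrier} {y z : Y} :
    A.LetterRel (.point g γ) y z ↔ A.MulRel g γ y z :=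
  exists_eq_left

theorem IsEquivariant.letterRel {φ : Y → Y'} (hφ : A.IsEquivariant A' φ) {l : F.Letter} {y z : Y}
    (h : A.LetterRel l y z) : A'.LetterRel l (φ y) (φ z) := by
  obtain ⟨g, S, hS, _ | _⟩ := l <;>
  · obtain ⟨γ, hγ, h⟩ := h
    exact ⟨γ, hγ, hφ.mulRel h⟩

theorem IsEquivariant.exists_letterRel {φ : Y → Y'} (hφ : A.IsEquivariant A' φ) {l : F.Letter}
    {y : Y} {z' : Y'} (h : A'.LetterRel l (φ y) z') : ∃ z, A.LetterRel l y z ∧ φ z = z' := by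
  obtain ⟨g, S, hS, _ | _⟩ := l
  · obtain ⟨γ, hγ, h⟩ := h
    obtain ⟨z, hz, rfl⟩ := hφ.exists_mulRel_left h
    exact ⟨z, ⟨γ, hγ, hz⟩, rfl⟩
  · obtain ⟨γ, hγ, h⟩ := h
    obtain ⟨z, hz, rfl⟩ := hφ.exists_mulRel_right h
    exact ⟨z, ⟨γ, hγ, hz⟩, rfl⟩

theorem wordRel_append {w w' : List F.Letter} {y z : Y} :
    A.WordRel (w ++ w') y z ↔ ∃ v, A.WordRel w y v ∧ A.WordRel w' v z := by
  induction w generalizing y with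
  | nil => simp [WordRel]
  | cons l w ih =>
    simp only [List.cons_append, WordRel, ih]
    exact ⟨fun ⟨v, hv, v', h, h'⟩ => ⟨v', ⟨v, hv, h⟩, h'⟩,
      fun ⟨v', ⟨v, hv, h⟩, h'⟩ => ⟨v, hv, v', h, h'⟩⟩

theorem wordRel_singleton {l : F.Letter} {y z : Y} : A.WordRel [l] y z ↔ A.LetterRel l y z := by
  simp [WordRel]

theorem wordRel_inv {w : List F.Letter} {y z : Y} :
    A.WordRel (wordInv w) y z ↔ A.WordRel w z y := by
  induction w generalizing y z with
  | nil => exact eq_comm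
  | cons l w ih =>
    have : wordInv (l :: w) = wordInv w ++ [l.flip] := by simp [wordInv]
    rw [this, wordRel_append]
    simp only [wordRel_singleton, letterRel_flip, ih]
    exact exists_congr fun v => and_comm

theorem WordRel.right_unique {w : List F.Letter} {y z z' : Y} (h : A.WordRel w y z)
    (h' : A.WordRel w y z') : z = z' := by
  induction w generalizing y with
  | nil => exact h.symm.trans h'
  | cons l w ih =>
    obtain ⟨v, hv, h⟩ := h
    obtain ⟨v', hv', h'⟩ := h'
    obtain rfl := hv.right_unique hv'
    exact ih h h'

theorem WordRel.left_unique {w : List F.Letter} {y y' z : Y} (h : A.WordRel w y z)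
    (h' : A.WordRel w y' z) : y = y' :=
  (wordRel_inv.2 h).right_unique (wordRel_inv.2 h')

theorem isOpen_setOf_wordRel {w : List F.Letter} (hw : ∀ l ∈ w, IsOpen l.slice) {V : Set Y}
    (hV : IsOpen V) : IsOpen {y | ∃ z ∈ V, A.WordRel w y z} := by
  induction w with
  | nil => simpa [WordRel] using hV
  | cons l w ih =>
    convert isOpen_setOf_letterRel (A := A) (hw l (by simp))
      (ih fun l' hl' => hw l' (List.mem_cons_of_mem _ hl')) using 1
    ext y
    exact ⟨fun ⟨z, hz, v, hv, h⟩ => ⟨v, ⟨z, hz, h⟩, hv⟩,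
      fun ⟨v, ⟨z, hz, h⟩, hv⟩ => ⟨z, hz, v, hv, h⟩⟩

theorem IsEquivariant.wordRel {φ : Y → Y'} (hφ : A.IsEquivariant A' φ) {w : List F.Letter}
    {y z : Y} (h : A.WordRel w y z) : A'.WordRel w (φ y) (φ z) := by
  induction w generalizing y with
  | nil => exact congrArg φ h
  | cons l w ih =>
    obtain ⟨v, hv, h⟩ := h
    exact ⟨φ v, hφ.letterRel hv, ih h⟩

theorem IsEquivariant.exists_wordRel {φ : Y → Y'} (hφ : A.IsEquivariant A' φ) {w : List F.Letter}
    {y : Y} {z' : Y'} (h : A'.WordRel w (φ y) z') : ∃ z, A.WordRel w y z ∧ φ z = z' := by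
  induction w generalizing y with
  | nil => exact ⟨y, rfl, h⟩
  | cons l w ih =>
    obtain ⟨v, hv, h⟩ := h
    obtain ⟨v, hv', rfl⟩ := hφ.exists_letterRel hv
    obtain ⟨z, hz, rfl⟩ := ih h
    exact ⟨z, ⟨v, hv', hz⟩, rfl⟩

/-! ### Behaviours of points -/

variable (A) in
/-- The set of words that are defined at a point. -/
def behaviour (y : Y) : Set (List F.Letter) := {w | ∃ z, A.WordRel w y z}

theorem IsEquivariant.behaviour_eq {φ : Y → Y'} (hφ : A.IsEquivariant A' φ) (y : Y) :
    A'.behaviour (φ y) = A.behaviour y := by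
  ext w
  constructor
  · rintro ⟨z', h⟩
    obtain ⟨z, hz, -⟩ := hφ.exists_wordRel h
    exact ⟨z, hz⟩
  · rintro ⟨z, h⟩
    exact ⟨φ z, hφ.wordRel h⟩

/-- Letters act by partial functions, so the behaviour of a point determines the behaviours of all
its translates by letters. -/
theorem LetterRel.mem_behaviour_iff {l : F.Letter} {y z : Y} (h : A.LetterRel l y z)
    {w : List F.Letter} : w ∈ A.behaviour z ↔ l :: w ∈ A.behaviour y := by
  constructor
  · rintro ⟨v, hv⟩
    exact ⟨v, z, h, hv⟩
  · rintro ⟨v, z', hz', hv⟩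
    obtain rfl := h.right_unique hz'
    exact ⟨v, hv⟩

theorem LetterRel.exists_of_behaviour_eq {l : F.Letter} {y z : Y} (h : A.LetterRel l y z)
    {y' : Y'} (hy : A'.behaviour y' = A.behaviour y) :
    ∃ z', A'.LetterRel l y' z' ∧ A'.behaviour z' = A.behaviour z := by
  have hl : [l] ∈ A'.behaviour y' := hy ▸ ⟨z, wordRel_singleton.2 h⟩
  obtain ⟨z', hz'⟩ := hl
  rw [wordRel_singleton] at hz'
  refine ⟨z', hz', ?_⟩
  ext w
  rw [hz'.mem_behaviour_iff, h.mem_behaviour_iff, hy]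

theorem MulRel.exists_of_behaviour_eq_left {x x' : C} {g : x ⟶ x'} {γ : (F.corr g).Carrier}
    {y z : Y} (h : A.MulRel g γ y z) {z' : Y'} (hz : A'.behaviour z' = A.behaviour z) :
    ∃ y', A'.MulRel g γ y' z' ∧ A'.behaviour y' = A.behaviour y := by
  have := LetterRel.exists_of_behaviour_eq (letterRel_flip.2 (letterRel_point.2 h)) hz
  simpa only [letterRel_flip, letterRel_point] using this

theorem MulRel.exists_of_behaviour_eq_right {x x' : C} {g : x ⟶ x'} {γ : (F.corr g).Carrier}
    {y z : Y} (h : A.MulRel g γ y z) {y' : Y'} (hy : A'.behaviour y' = A.behaviour y) :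
    ∃ z', A'.MulRel g γ y' z' ∧ A'.behaviour z' = A.behaviour z := by
  have := LetterRel.exists_of_behaviour_eq (letterRel_point.2 h) hy
  simpa only [letterRel_point] using this

/-- The unit arrow at the anchor of `y`, as a one-element slice, is a letter defined at `y` and
hence at `y'`. Being defined there records both the piece and, in the next lemma, the anchor. -/
theorem mem_piece_of_behaviour_eq {y : Y} {y' : Y'} (h : A'.behaviour y' = A.behaviour y) {x : C}
    (hy : y ∈ A.piece x) : y' ∈ A'.piece x := by
  obtain ⟨z', hz', -⟩ := (MulRel.unit hy).exists_of_behaviour_eq_right h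
  exact hz'.1

theorem anchor_eq_of_behaviour_eq {y : Y} {y' : Y'} (h : A'.behaviour y' = A.behaviour y) {x : C}
    (hy : y ∈ A.piece x) (hy' : y' ∈ A'.piece x) : A'.anchor x ⟨y', hy'⟩ = A.anchor x ⟨y, hy⟩ := by
  obtain ⟨z', ⟨_, e, -⟩, -⟩ := (MulRel.unit hy).exists_of_behaviour_eq_right h
  rw [(F.unitIso x).right_anchor, (F.gr x).s_unit] at e
  exact e.symm

end Action
end GroupoidDiagram

/-! ### The universal `F`-action on the space of behaviours -/

namespace GroupoidDiagram

variable {C : Type u} [SmallCategory C]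

/-- The underlying space of the universal `F`-action: the behaviours of points in `F`-actions. -/
def Universal (F : GroupoidDiagram C) : Type u :=
  {W : Set (List F.Letter) // ∃ (Y : Type u) (_ : TopologicalSpace Y) (A : F.Action Y) (y : Y),
    A.behaviour y = W}

variable {F : GroupoidDiagram C}

/-- The canonical map from an `F`-action to the universal one. -/
def Action.toUniversal {Y : Type u} [TopologicalSpace Y] (A : F.Action Y) (y : Y) : F.Universal :=
  ⟨A.behaviour y, Y, _, A, y, rfl⟩

/-- The final topology for the canonical maps. -/
instance : TopologicalSpace F.Universal where
  IsOpen V := ∀ (Y : Type u) [TopologicalSpace Y] (A : F.Action Y), IsOpen (A.toUniversal ⁻¹' V)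
  isOpen_univ _ _ _ := isOpen_univ
  isOpen_inter _ _ h h' Y _ A := (h Y A).inter (h' Y A)
  isOpen_sUnion s hs Y _ A := by
    rw [preimage_sUnion]
    exact isOpen_biUnion fun t ht => hs t ht Y A

theorem Action.continuous_toUniversal {Y : Type u} [TopologicalSpace Y] (A : F.Action Y) :
    Continuous A.toUniversal :=
  continuous_def.2 fun _ hV => hV Y A

namespace Universal

theorem exists_toUniversal_eq (ω : F.Universal) :
    ∃ (Y : Type u) (_ : TopologicalSpace Y) (A : F.Action Y) (y : Y), A.toUniversal y = ω := by
  obtain ⟨_, Y, _, A, y, rfl⟩ := ω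
  exact ⟨Y, _, A, y, rfl⟩

theorem toUniversal_eq_iff {Y Y' : Type u} [TopologicalSpace Y] [TopologicalSpace Y']
    {A : F.Action Y} {A' : F.Action Y'} {y : Y} {y' : Y'} :
    A.toUniversal y = A'.toUniversal y' ↔ A.behaviour y = A'.behaviour y' :=
  Subtype.ext_iff

variable (F) in
/-- The pieces of the universal action. -/
def piece (x : C) : Set F.Universal :=
  {ω | ∃ (Y : Type u) (_ : TopologicalSpace Y) (A : F.Action Y) (y : A.piece x),
    A.toUniversal y = ω}

theorem toUniversal_mem_piece_iff {Y : Type u} [TopologicalSpace Y] {A : F.Action Y} {x : C}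
    {y : Y} : A.toUniversal y ∈ piece F x ↔ y ∈ A.piece x := by
  constructor
  · rintro ⟨Y', _, A', y', h⟩
    exact Action.mem_piece_of_behaviour_eq (toUniversal_eq_iff.1 h.symm) y'.2
  · exact fun h => ⟨Y, _, A, ⟨y, h⟩, rfl⟩

/-- The canonical map on a piece. -/
def ofPiece {Y : Type u} [TopologicalSpace Y] (A : F.Action Y) {x : C} (y : A.piece x) :
    piece F x :=
  ⟨A.toUniversal y, toUniversal_mem_piece_iff.2 y.2⟩

theorem exists_ofPiece_eq {x : C} (ω : piece F x) :
    ∃ (Y : Type u) (_ : TopologicalSpace Y) (A : F.Action Y) (y : A.piece x), ofPiece A y = ω := by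
  obtain ⟨_, Y, _, A, y, rfl⟩ := ω
  exact ⟨Y, _, A, y, rfl⟩

theorem isOpen_image_val {x : C} {V : Set (piece F x)}
    (h : ∀ (Y : Type u) [TopologicalSpace Y] (A : F.Action Y),
      IsOpen {y : Y | ∃ hy : y ∈ A.piece x, ofPiece A ⟨y, hy⟩ ∈ V}) :
    IsOpen (Subtype.val '' V) := by
  intro Y _ A
  convert h Y A using 1
  ext y
  constructor
  · rintro ⟨⟨ω, hω⟩, hV, rfl⟩
    exact ⟨toUniversal_mem_piece_iff.1 hω, hV⟩
  · rintro ⟨hy, hV⟩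
    exact ⟨_, hV, rfl⟩

theorem isOpen_of_ofPiece {x : C} {V : Set (piece F x)}
    (h : ∀ (Y : Type u) [TopologicalSpace Y] (A : F.Action Y),
      IsOpen {y : Y | ∃ hy : y ∈ A.piece x, ofPiece A ⟨y, hy⟩ ∈ V}) : IsOpen V := by
  rw [← preimage_image_eq V Subtype.val_injective]
  exact (isOpen_image_val h).preimage continuous_subtype_val

theorem isOpen_piece (x : C) : IsOpen (piece F x) := by
  intro Y _ A
  convert (A.isClopen_piece x).isOpen using 1
  ext y
  exact toUniversal_mem_piece_iff

/-- The anchor map of the universal action. -/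
noncomputable def anchor (x : C) (ω : piece F x) : (F.gr x).Obj :=
  let h := exists_ofPiece_eq ω
  letI := h.choose_spec.choose
  h.choose_spec.choose_spec.choose.anchor x h.choose_spec.choose_spec.choose_spec.choose

theorem anchor_ofPiece {Y : Type u} [TopologicalSpace Y] (A : F.Action Y) {x : C}
    (y : A.piece x) : anchor x (ofPiece A y) = A.anchor x y := by
  have h := exists_ofPiece_eq (ofPiece A y)
  let := h.choose_spec.choose
  exact Action.anchor_eq_of_behaviour_eq
    (toUniversal_eq_iff.1 (congrArg Subtype.val h.choose_spec.choose_spec.choose_spec.choose_spec))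
    y.2 (Subtype.coe_prop _)

/-- The behaviour of `γ · y` depends only on `γ` and the behaviour of `y`, so the product is
independent of the `F`-action chosen to represent `ω`. -/
theorem exists_act {x x' : C} (g : x ⟶ x') (γ : (F.corr g).Carrier) (ω : piece F x)
    (e : (F.corr g).right.anchor γ = anchor x ω) :
    ∃ ζ : piece F x', ∀ (Y : Type u) [TopologicalSpace Y] (A : F.Action Y) (y : A.piece x)
      (_ : ofPiece A y = ω) (e' : (F.corr g).right.anchor γ = A.anchor x y),
      ofPiece A (A.act g γ y e') = ζ := by
  obtain ⟨Y, _, A, y, rfl⟩ := exists_ofPiece_eq ω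
  rw [anchor_ofPiece] at e
  refine ⟨ofPiece A (A.act g γ y e), ?_⟩
  intro Y' _ A' y' hy e'
  obtain ⟨z, hz, hz'⟩ := Action.MulRel.exists_of_behaviour_eq_right (A := A) (A' := A')
    (⟨y.2, e, rfl⟩ : A.MulRel g γ y _) (toUniversal_eq_iff.1 (congrArg Subtype.val hy))
  obtain rfl := hz.right_unique ⟨y'.2, e', rfl⟩
  exact Subtype.ext (toUniversal_eq_iff.2 hz')

/-- The multiplication maps of the universal action. -/
noncomputable def act {x x' : C} (g : x ⟶ x') (γ : (F.corr g).Carrier) (ω : piece F x)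
    (e : (F.corr g).right.anchor γ = anchor x ω) : piece F x' :=
  (exists_act g γ ω e).choose

theorem act_ofPiece {Y : Type u} [TopologicalSpace Y] (A : F.Action Y) {x x' : C} (g : x ⟶ x')
    (γ : (F.corr g).Carrier) (y : A.piece x)
    (e : (F.corr g).right.anchor γ = anchor x (ofPiece A y)) :
    act g γ (ofPiece A y) e = ofPiece A (A.act g γ y (e.trans (anchor_ofPiece A y))) :=
  ((exists_act g γ _ e).choose_spec Y A y rfl _).symm

/-- Equations in the universal action can be solved inside any given `F`-action that represents the
product. This gives openness of multiplication and the second condition on `F`-actions. -/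
theorem exists_mulRel_of_act_eq_ofPiece {Y : Type u} [TopologicalSpace Y] {A : F.Action Y}
    {x x' : C} {g : x ⟶ x'} {γ : (F.corr g).Carrier} {ω : piece F x}
    {e : (F.corr g).right.anchor γ = anchor x ω} {z : A.piece x'}
    (h : act g γ ω e = ofPiece A z) : ∃ y : A.piece x, A.MulRel g γ y z ∧ ofPiece A y = ω := by
  obtain ⟨Y', _, A', y', rfl⟩ := exists_ofPiece_eq ω
  rw [act_ofPiece] at h
  obtain ⟨y, hy, hb⟩ := Action.MulRel.exists_of_behaviour_eq_left
    (⟨y'.2, e.trans (anchor_ofPiece A' y'), rfl⟩ : A'.MulRel g γ y' _)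
    (toUniversal_eq_iff.1 (congrArg Subtype.val h.symm))
  exact ⟨⟨y, hy.1⟩, hy, Subtype.ext (toUniversal_eq_iff.2 hb)⟩

variable (F) in
/-- The universal action. -/
noncomputable def action : F.Action F.Universal where
  piece := piece F
  anchor := anchor
  act := act
  isClopen_piece x := by
    refine ⟨⟨?_⟩, isOpen_piece x⟩
    intro Y _ A
    convert (A.isClopen_piece x).compl.isOpen using 1
    ext y
    exact not_congr toUniversal_mem_piece_iff
  existsUnique_piece ω := by
    obtain ⟨Y, _, A, y, rfl⟩ := exists_toUniversal_eq ω
    simp only [toUniversal_mem_piece_iff]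
    exact A.existsUnique_piece y
  continuous_anchor x := by
    refine continuous_def.2 fun V hV => isOpen_of_ofPiece fun Y _ A => ?_
    convert (A.isClopen_piece x).isOpen.isOpenMap_subtype_val _
      (hV.preimage (A.continuous_anchor x)) using 1
    ext y
    simp only [mem_preimage, anchor_ofPiece]
    exact ⟨fun ⟨hy, h⟩ => ⟨⟨y, hy⟩, h, rfl⟩, by rintro ⟨y, h, rfl⟩; exact ⟨y.2, h⟩⟩
  continuous_act {x x'} g := by
    refine GroupoidCorrespondence.continuous_of_isSlice fun S hSo hS W hW =>
      isOpen_of_ofPiece fun Y _ A => ?_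
    obtain ⟨O, hO, rfl⟩ := isOpen_induced_iff.1 hW
    -- Pulled back to `Y`, the set to be tested is the preimage under the slice of the open set
    -- `A.toUniversal ⁻¹' O`.
    convert Action.isOpen_setOf_sliceRel_left (A := A) g hSo (hO Y A) using 1
    ext y
    constructor
    · rintro ⟨hy, γ, hγ, e, h⟩
      simp only [act_ofPiece] at h
      exact ⟨_, h, γ, hγ, hy, _, rfl⟩
    · rintro ⟨_, hz, γ, hγ, hy, e, rfl⟩
      refine ⟨hy, γ, hγ, e.trans (anchor_ofPiece A _).symm, ?_⟩
      simp only [act_ofPiece]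
      exact hz
  isOpenMap_act {x x'} g := by
    refine GroupoidCorrespondence.isOpenMap_of_isSlice fun S hSo hS V hV =>
      isOpen_of_ofPiece fun Y _ A => ?_
    obtain ⟨O, hO, rfl⟩ := isOpen_induced_iff.1 hV
    convert Action.isOpen_setOf_sliceRel_right (A := A) g hSo (hO Y A) using 1
    ext z
    constructor
    · rintro ⟨hz, γ, hγ, ω, hω, e, h⟩
      obtain ⟨y, hy, rfl⟩ := exists_mulRel_of_act_eq_ofPiece h
      exact ⟨y, hω, γ, hγ, hy⟩
    · rintro ⟨y, hyO, γ, hγ, hy, e, rfl⟩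
      exact ⟨Subtype.coe_prop _, γ, hγ, ofPiece A ⟨y, hy⟩, hyO, e.trans (anchor_ofPiece A _).symm,
        act_ofPiece A g γ ⟨y, hy⟩ _⟩
  surjective_act {x x'} g ω := by
    obtain ⟨Y, _, A, z, rfl⟩ := exists_ofPiece_eq ω
    obtain ⟨⟨⟨γ, y⟩, e⟩, rfl⟩ := A.surjective_act g z
    exact ⟨⟨(γ, ofPiece A y), e.trans (anchor_ofPiece A _).symm⟩, act_ofPiece A g γ y _⟩
  anchor_act g γ ω e := by
    obtain ⟨Y, _, A, y, rfl⟩ := exists_ofPiece_eq ω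
    rw [act_ofPiece, anchor_ofPiece, A.anchor_act]
  act_act g₁ g₂ γ₁ γ₂ ω e₁ e₂ := by
    obtain ⟨Y, _, A, y, rfl⟩ := exists_ofPiece_eq ω
    simp only [act_ofPiece, A.act_act g₁ g₂ γ₁ γ₂ y e₁ (e₂.trans (anchor_ofPiece A y))]
    exact (act_ofPiece A _ _ y _).symm
  exists_of_act_eq {x x'} g γ γ' ω ω' e e' h := by
    obtain ⟨Y, _, A, y', rfl⟩ := exists_ofPiece_eq ω'
    rw [act_ofPiece] at h
    -- Replaces `ω` by a point of the same `F`-action as `y'`, so that the second condition can be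
    -- applied there.
    obtain ⟨y, hy, rfl⟩ := exists_mulRel_of_act_eq_ofPiece h
    obtain ⟨hy, e₁, h₁⟩ := hy
    obtain ⟨η, h₁, h₂, h₃, h₄⟩ := A.exists_of_act_eq g γ γ' _ y' _ _ (Subtype.ext h₁)
    refine ⟨η, h₁, h₂.trans (anchor_ofPiece A y').symm, h₃, ?_⟩
    rw [act_ofPiece, ← h₄]

theorem isEquivariant_toUniversal {Y : Type u} [TopologicalSpace Y] (A : F.Action Y) :
    A.IsEquivariant (action F) A.toUniversal :=
  ⟨fun _ y => toUniversal_mem_piece_iff.2 y.2, fun _ y => anchor_ofPiece A y, fun g γ y e =>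
    (congrArg Subtype.val (act_ofPiece A g γ y (e.trans (anchor_ofPiece A y).symm))).symm⟩

/-- The canonical maps are equivariant and so preserve behaviour: the behaviour of `ω` as a point of
the universal action is `ω` itself. This gives uniqueness in `eq_toUniversal`. -/
theorem toUniversal_action (ω : F.Universal) : (action F).toUniversal ω = ω := by
  obtain ⟨Y, _, A, y, rfl⟩ := exists_toUniversal_eq ω
  exact toUniversal_eq_iff.2 ((isEquivariant_toUniversal A).behaviour_eq y)

theorem _root_.GroupoidDiagram.Action.IsEquivariant.toUniversal_eq {Y Y' : Type u}
    [TopologicalSpace Y] [TopologicalSpace Y'] {A : F.Action Y} {A' : F.Action Y'} {φ : Y → Y'}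
    (hφ : A.IsEquivariant A' φ) (y : Y) : A'.toUniversal (φ y) = A.toUniversal y :=
  toUniversal_eq_iff.2 (hφ.behaviour_eq y)

theorem eq_toUniversal {Y : Type u} [TopologicalSpace Y] {A : F.Action Y} {φ : Y → F.Universal}
    (hφ : A.IsEquivariant (action F) φ) (y : Y) : φ y = A.toUniversal y := by
  rw [← hφ.toUniversal_eq, toUniversal_action]

theorem isUniversal : (action F).IsUniversal := fun _ _ A =>
  ⟨⟨A.toUniversal, A.continuous_toUniversal⟩, isEquivariant_toUniversal A,
    fun _ hφ => ContinuousMap.ext fun y => eq_toUniversal hφ y⟩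

end Universal
end GroupoidDiagram

/-! ### Germs of words in open slices -/

namespace GroupoidDiagram

variable {C : Type u} [SmallCategory C] {F : GroupoidDiagram C}

/-- A word in open slices. -/
def IsOpenWord (w : List F.Letter) : Prop := ∀ l ∈ w, IsOpen l.slice

theorem IsOpenWord.nil : IsOpenWord ([] : List F.Letter) := fun _ h => by simp at h

theorem IsOpenWord.append {w w' : List F.Letter} (h : IsOpenWord w) (h' : IsOpenWord w') :
    IsOpenWord (w ++ w') := fun l hl => (List.mem_append.1 hl).elim (h l) (h' l)

theorem IsOpenWord.inv {w : List F.Letter} (h : IsOpenWord w) : IsOpenWord (wordInv w) := by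
  intro l hl
  obtain ⟨l', hl', rfl⟩ := List.mem_map.1 (List.mem_reverse.1 hl)
  exact h l' hl'

namespace Universal

theorem wordRel_toUniversal {Y : Type u} [TopologicalSpace Y] {A : F.Action Y}
    {w : List F.Letter} {y z : Y} (h : A.WordRel w y z) :
    (action F).WordRel w (A.toUniversal y) (A.toUniversal z) :=
  (isEquivariant_toUniversal A).wordRel h

theorem exists_wordRel {Y : Type u} [TopologicalSpace Y] {A : F.Action Y}
    {w : List F.Letter} {y : Y} {ζ : F.Universal}
    (h : (action F).WordRel w (A.toUniversal y) ζ) : ∃ z, A.WordRel w y z ∧ A.toUniversal z = ζ :=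
  (isEquivariant_toUniversal A).exists_wordRel h

end Universal

open Universal

/-- Two words have the same germ at `ω` if they act in the same way, in any `F`-action, on all
points that lie over a suitable neighbourhood of `ω`. -/
def GermEq (ω : F.Universal) (w w' : List F.Letter) : Prop :=
  ∃ V, IsOpen V ∧ ω ∈ V ∧ ∀ (Y : Type u) [TopologicalSpace Y] (A : F.Action Y) (y : Y),
    A.toUniversal y ∈ V → ∀ z, A.WordRel w y z ↔ A.WordRel w' y z

namespace GermEq

variable {ω ζ : F.Universal} {w w' w₁ w₁' w₂ w₂' : List F.Letter}

theorem refl (ω : F.Universal) (w : List F.Letter) : GermEq ω w w :=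
  ⟨univ, isOpen_univ, mem_univ _, fun _ _ _ _ _ _ => Iff.rfl⟩

theorem symm (h : GermEq ω w w') : GermEq ω w' w :=
  let ⟨V, hV, hω, h⟩ := h
  ⟨V, hV, hω, fun Y _ A y hy z => (h Y A y hy z).symm⟩

theorem trans (h : GermEq ω w w₁) (h' : GermEq ω w₁ w') : GermEq ω w w' :=
  let ⟨V, hV, hω, h⟩ := h
  let ⟨V', hV', hω', h'⟩ := h'
  ⟨V ∩ V', hV.inter hV', ⟨hω, hω'⟩, fun Y _ A y hy z => (h Y A y hy.1 z).trans (h' Y A y hy.2 z)⟩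

theorem wordRel_iff (h : GermEq ω w w') {Y : Type u} [TopologicalSpace Y] {A : F.Action Y} {y : Y}
    (hy : A.toUniversal y = ω) {z : Y} : A.WordRel w y z ↔ A.WordRel w' y z :=
  let ⟨_, _, hω, h⟩ := h
  h Y A y (hy ▸ hω) z

/-- Points over the intersection of `V₁` with the domain where `w₁` maps into `V₂` are moved by `w₁`
to points over `V₂`. This domain is open because the letters of `w₁` are. -/
theorem append (h₁ : GermEq ω w₁ w₁') (hw₁ : IsOpenWord w₁) (h : (action F).WordRel w₁ ω ζ)
    (h₂ : GermEq ζ w₂ w₂') : GermEq ω (w₁ ++ w₂) (w₁' ++ w₂') := by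
  obtain ⟨V₁, hV₁, hω, h₁⟩ := h₁
  obtain ⟨V₂, hV₂, hζ, h₂⟩ := h₂
  refine ⟨V₁ ∩ {ω | ∃ ζ ∈ V₂, (action F).WordRel w₁ ω ζ},
    hV₁.inter (Action.isOpen_setOf_wordRel hw₁ hV₂), ⟨hω, ζ, hζ, h⟩, ?_⟩
  rintro Y _ A y ⟨hy₁, ζ', hζ', hy₂⟩ z
  rw [Action.wordRel_append, Action.wordRel_append]
  refine exists_congr fun v => ?_
  rw [← h₁ Y A y hy₁]
  refine and_congr_right fun hv => h₂ Y A v ?_ z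
  rwa [(wordRel_toUniversal hv).right_unique hy₂]

/-- The neighbourhood consists of the points that both inverse words carry into `V`; whichever
inverse is applied to a point over it, the result lies over `V`, where the two words agree. -/
theorem inv (h : GermEq ω w w') (hw : IsOpenWord w) (hw' : IsOpenWord w')
    (hζ : (action F).WordRel w ω ζ) : GermEq ζ (wordInv w) (wordInv w') := by
  have hζ' := (h.wordRel_iff (toUniversal_action ω)).1 hζ
  obtain ⟨V, hV, hω, h⟩ := h
  refine ⟨{ζ | ∃ ω ∈ V, (action F).WordRel (wordInv w) ζ ω} ∩
    {ζ | ∃ ω ∈ V, (action F).WordRel (wordInv w') ζ ω},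
    (Action.isOpen_setOf_wordRel hw.inv hV).inter (Action.isOpen_setOf_wordRel hw'.inv hV),
    ⟨⟨ω, hω, Action.wordRel_inv.2 hζ⟩, ⟨ω, hω, Action.wordRel_inv.2 hζ'⟩⟩, ?_⟩
  rintro Y _ A y ⟨⟨ω₁, hω₁, h₁⟩, ⟨ω₂, hω₂, h₂⟩⟩ z
  rw [Action.wordRel_inv] at *
  rw [Action.wordRel_inv]
  constructor
  · intro hz
    refine (h Y A z ?_ y).1 hz
    rwa [(wordRel_toUniversal hz).left_unique h₁]
  · intro hz
    refine (h Y A z ?_ y).2 hz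
    rwa [(wordRel_toUniversal hz).left_unique h₂]

theorem wordInv_append (h : (action F).WordRel w ω ζ) (hw : IsOpenWord w) :
    GermEq ω (w ++ wordInv w) [] := by
  refine ⟨_, Action.isOpen_setOf_wordRel hw isOpen_univ, ⟨ζ, mem_univ _, h⟩, ?_⟩
  rintro Y _ A y ⟨ζ', -, hy⟩ z
  obtain ⟨v, hv, -⟩ := exists_wordRel hy
  rw [Action.wordRel_append]
  simp only [Action.wordRel_inv]
  constructor
  · rintro ⟨v', h₁, h₂⟩
    exact h₁.left_unique h₂
  · rintro rfl
    exact ⟨v, hv, hv⟩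

end GermEq

/-- A word in open slices with a point of the universal action at which it is defined. -/
structure PointedWord (F : GroupoidDiagram C) where
  source : F.Universal
  word : List F.Letter
  isOpenWord : IsOpenWord word
  target : F.Universal
  wordRel : (action F).WordRel word source target

/-- The germ relation on pointed words. -/
instance PointedWord.setoid (F : GroupoidDiagram C) : Setoid F.PointedWord where
  r p q := p.source = q.source ∧ GermEq p.source p.word q.word
  iseqv :=
    { refl := fun _ => ⟨rfl, .refl _ _⟩
      symm := fun h => ⟨h.1.symm, h.1 ▸ h.2.symm⟩
      trans := fun h h' => ⟨h.1.trans h'.1, h.2.trans (h.1 ▸ h'.2)⟩ }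

theorem PointedWord.target_eq {p q : F.PointedWord} (h : p ≈ q) : p.target = q.target := by
  obtain ⟨h₁, h₂⟩ := h
  have := (h₂.wordRel_iff (toUniversal_action _)).1 p.wordRel
  rw [h₁] at this
  exact this.right_unique q.wordRel

/-- Composition of pointed words. -/
def PointedWord.comp (p q : F.PointedWord) (e : p.source = q.target) : F.PointedWord where
  source := q.source
  -- The product applies `q` first, and words act from left to right.
  word := q.word ++ p.word
  isOpenWord := q.isOpenWord.append p.isOpenWord
  target := p.target
  wordRel := Action.wordRel_append.2 ⟨_, q.wordRel, e ▸ p.wordRel⟩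

/-- The inverse of a pointed word. -/
def PointedWord.inv (p : F.PointedWord) : F.PointedWord where
  source := p.target
  word := wordInv p.word
  isOpenWord := p.isOpenWord.inv
  target := p.source
  wordRel := Action.wordRel_inv.2 p.wordRel

/-- The empty word at a point. -/
def PointedWord.unit (ω : F.Universal) : F.PointedWord := ⟨ω, [], .nil, ω, rfl⟩

/-- The arrow space of the groupoid model: germs of words in open slices. -/
def Germ (F : GroupoidDiagram C) : Type u := Quotient (PointedWord.setoid F)

/-! ### The étale groupoid of germs -/

namespace Germ

/-- The germ of a pointed word. -/
def mk (p : F.PointedWord) : F.Germ := Quotient.mk _ p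

theorem mk_eq_iff {p q : F.PointedWord} :
    mk p = mk q ↔ p.source = q.source ∧ GermEq p.source p.word q.word :=
  Quotient.eq

theorem exists_mk_eq (u : F.Germ) : ∃ p, mk p = u := Quotient.exists_rep u

theorem mk_congr {p q : F.PointedWord} (h : p.source = q.source) (h' : p.word = q.word) :
    mk p = mk q :=
  mk_eq_iff.2 ⟨h, h' ▸ .refl _ _⟩

/-- The source of a germ. -/
def source (u : F.Germ) : F.Universal :=
  Quotient.lift PointedWord.source (fun _ _ (h : _ ∧ _) => h.1) u

/-- The range of a germ. -/
def target (u : F.Germ) : F.Universal :=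
  Quotient.lift PointedWord.target (fun _ _ h => PointedWord.target_eq h) u

/-- The inverse of a germ. -/
def inv (u : F.Germ) : F.Germ :=
  Quotient.map PointedWord.inv (fun p q h =>
    ⟨PointedWord.target_eq h, h.2.inv p.isOpenWord q.isOpenWord p.wordRel⟩) u

/-- The product of composable germs. -/
noncomputable def mul (u v : F.Germ) (e : u.source = v.target) : F.Germ :=
  mk (u.exists_mk_eq.choose.comp v.exists_mk_eq.choose (by
    rw [← u.exists_mk_eq.choose_spec, ← v.exists_mk_eq.choose_spec] at e
    exact e))

@[simp] theorem source_mk (p : F.PointedWord) : (mk p).source = p.source := rfl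

@[simp] theorem inv_mk (p : F.PointedWord) : (mk p).inv = mk p.inv := rfl

/-- Products of germs do not depend on the chosen representatives, by compatibility of germ equality
with concatenation. -/
theorem mul_mk (p q : F.PointedWord) (e : p.source = q.target) :
    mul (mk p) (mk q) e = mk (p.comp q e) := by
  have h := mk_eq_iff.1 (mk p).exists_mk_eq.choose_spec
  have h' := mk_eq_iff.1 (mk q).exists_mk_eq.choose_spec
  refine mk_eq_iff.2 ⟨h'.1, ?_⟩
  refine h'.2.append (PointedWord.isOpenWord _) (PointedWord.wordRel _) ?_
  have h₁ : (mk q).exists_mk_eq.choose.target = (mk p).exists_mk_eq.choose.source := by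
    rw [h.1, e]
    exact PointedWord.target_eq h'
  rw [h₁]
  exact h.2

/-- The final topology for the sections that send `ω` to the germ of `w` at `ω`, defined on the
domains of the words `w`. Words with a non-open letter carry no pointed words and impose no
condition. -/
instance : TopologicalSpace F.Germ where
  IsOpen T := ∀ w, IsOpen {ω | ∃ p : F.PointedWord, p.source = ω ∧ p.word = w ∧ mk p ∈ T}
  isOpen_univ w := by
    by_cases hw : IsOpenWord w
    · convert Action.isOpen_setOf_wordRel (A := action F) hw isOpen_univ using 1
      ext ω
      constructor
      · rintro ⟨p, rfl, rfl, -⟩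
        exact ⟨p.target, mem_univ _, p.wordRel⟩
      · rintro ⟨ζ, -, h⟩
        exact ⟨⟨ω, w, hw, ζ, h⟩, rfl, rfl, mem_univ _⟩
    · convert isOpen_empty
      rw [eq_empty_iff_forall_notMem]
      rintro _ ⟨p, rfl, rfl, -⟩
      exact hw p.isOpenWord
  isOpen_inter T T' h h' w := by
    convert (h w).inter (h' w) using 1
    ext ω
    constructor
    · rintro ⟨p, rfl, rfl, hp⟩
      exact ⟨⟨p, rfl, rfl, hp.1⟩, p, rfl, rfl, hp.2⟩
    · rintro ⟨⟨p, rfl, rfl, hp⟩, q, hq, hq', hqT⟩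
      exact ⟨p, rfl, rfl, hp, mk_congr hq hq' ▸ hqT⟩
  isOpen_sUnion s hs w := by
    convert isOpen_biUnion fun T hT => hs T hT w using 1
    ext ω
    simp only [mem_iUnion]
    constructor
    · rintro ⟨p, hp, hw, T, hT, h⟩
      exact ⟨T, hT, p, hp, hw, h⟩
    · rintro ⟨T, hT, p, hp, hw, h⟩
      exact ⟨p, hp, hw, T, hT, h⟩

/-- The germs of a word. -/
def ofWord (w : List F.Letter) : Set F.Germ := {u | ∃ p : F.PointedWord, p.word = w ∧ mk p = u}

theorem mk_mem_ofWord (p : F.PointedWord) : mk p ∈ ofWord p.word := ⟨p, rfl, rfl⟩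

/-- A neighbourhood witnessing equality of two germs also witnesses it at each of its points, so two
word sections agree on an open set. -/
theorem isOpen_ofWord (w : List F.Letter) : IsOpen (ofWord w) := by
  intro w'
  rw [isOpen_iff_forall_mem_open]
  rintro _ ⟨p, rfl, rfl, q, rfl, h⟩
  obtain ⟨h₁, V, hV, hω, h₂⟩ := mk_eq_iff.1 h
  refine ⟨V ∩ {ω | ∃ ζ ∈ univ, (action F).WordRel q.word ω ζ}, ?_,
    hV.inter (Action.isOpen_setOf_wordRel q.isOpenWord isOpen_univ),
    ⟨h₁ ▸ hω, q.target, mem_univ _, h₁ ▸ q.wordRel⟩⟩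
  rintro ω ⟨hωV, ζ, -, hζ⟩
  -- Germ equality is applied to the universal action itself, whose canonical map is the identity.
  have hζ' := (h₂ _ (action F) ω ((toUniversal_action ω).symm ▸ hωV) ζ).1 hζ
  exact ⟨⟨ω, p.word, p.isOpenWord, ζ, hζ'⟩, rfl, rfl, ⟨ω, q.word, q.isOpenWord, ζ, hζ⟩, rfl,
    mk_eq_iff.2 ⟨rfl, V, hV, hωV, h₂⟩⟩

theorem injOn_source_ofWord (w : List F.Letter) : InjOn source (ofWord w) := by
  rintro _ ⟨p, rfl, rfl⟩ _ ⟨q, hq, rfl⟩ h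
  exact mk_congr h hq.symm

theorem isOpenMap_source : IsOpenMap (source : F.Germ → F.Universal) := by
  intro T hT
  convert isOpen_iUnion hT using 1
  ext ω
  simp only [mem_iUnion]
  constructor
  · rintro ⟨u, hu, rfl⟩
    obtain ⟨p, rfl⟩ := u.exists_mk_eq
    exact ⟨p.word, p, rfl, rfl, hu⟩
  · rintro ⟨_, p, rfl, rfl, hu⟩
    exact ⟨_, hu, rfl⟩

theorem continuous_target : Continuous (target : F.Germ → F.Universal) := by
  refine continuous_def.2 fun V hV w => ?_
  by_cases hw : IsOpenWord w
  · convert Action.isOpen_setOf_wordRel (A := action F) hw hV using 1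
    ext ω
    constructor
    · rintro ⟨p, rfl, rfl, h⟩
      exact ⟨p.target, h, p.wordRel⟩
    · rintro ⟨ζ, hζ, h⟩
      exact ⟨⟨ω, w, hw, ζ, h⟩, rfl, rfl, hζ⟩
  · convert isOpen_empty
    rw [eq_empty_iff_forall_notMem]
    rintro _ ⟨p, rfl, rfl, -⟩
    exact hw p.isOpenWord

theorem continuous_source : Continuous (source : F.Germ → F.Universal) := by
  refine continuous_def.2 fun V hV w => ?_
  -- Openness of the whole germ space, evaluated at `w`, says that `w` has open domain.
  convert hV.inter (isOpen_univ (X := F.Germ) w) using 1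
  ext ω
  constructor
  · rintro ⟨p, rfl, rfl, h⟩
    exact ⟨h, p, rfl, rfl, mem_univ _⟩
  · rintro ⟨h, p, rfl, rfl, -⟩
    exact ⟨p, rfl, rfl, h⟩

theorem isLocalHomeomorph_source : IsLocalHomeomorph (source : F.Germ → F.Universal) := by
  refine isLocalHomeomorph_iff_isOpenEmbedding_restrict.2 fun u => ?_
  obtain ⟨p, rfl⟩ := u.exists_mk_eq
  exact ⟨ofWord p.word, (isOpen_ofWord _).mem_nhds (mk_mem_ofWord p),
    .of_continuous_injective_isOpenMap (continuous_source.comp continuous_subtype_val)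
      (injOn_source_ofWord _).injective (isOpenMap_source.domRestrict (isOpen_ofWord _))⟩

/-- A map to the space of germs is continuous if it is locally given by germs of a single word, at
points that vary continuously. -/
theorem continuous_of_ofWord {Z : Type*} [TopologicalSpace Z] {f : Z → F.Germ}
    (hs : Continuous fun z => (f z).source) (h : ∀ z, ∃ w, ∀ᶠ z' in 𝓝 z, f z' ∈ ofWord w) :
    Continuous f := by
  refine continuous_iff_continuousAt.2 fun z => ?_
  obtain ⟨w, hw⟩ := h z
  intro T hT
  obtain ⟨T', hT', hTo, hzT⟩ := mem_nhds_iff.1 hT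
  change f ⁻¹' T ∈ 𝓝 z
  obtain ⟨p, rfl, hp⟩ := hw.self_of_nhds
  have hz : (f z).source ∈ {ω | ∃ q : F.PointedWord, q.source = ω ∧ q.word = p.word ∧ mk q ∈ T'} :=
    ⟨p, by rw [← hp, source_mk], rfl, by rwa [hp]⟩
  filter_upwards [hw, hs.continuousAt.preimage_mem_nhds ((hTo p.word).mem_nhds hz)]
  rintro z' ⟨p', hp', hz'⟩ ⟨q, hq, hq', hqT⟩
  refine hT' ?_
  rw [← hz', ← mk_congr (p := q) (q := p') (hq.trans (congrArg source hz'.symm)) (hq'.trans hp'.symm)]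
  exact hqT

theorem continuous_inv : Continuous (inv : F.Germ → F.Germ) := by
  refine continuous_of_ofWord ?_ fun u => ?_
  · convert continuous_target (F := F) using 2 with u
    obtain ⟨p, rfl⟩ := u.exists_mk_eq
    rfl
  · obtain ⟨p, rfl⟩ := u.exists_mk_eq
    refine ⟨wordInv p.word, ?_⟩
    filter_upwards [(isOpen_ofWord _).mem_nhds (mk_mem_ofWord p)]
    rintro _ ⟨q, hq, rfl⟩
    exact ⟨q.inv, congrArg wordInv hq, rfl⟩

theorem wordInv_wordInv (w : List F.Letter) : wordInv (wordInv w) = w := by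
  have : ∀ l : F.Letter, l.flip.flip = l := fun ⟨_, _, _, b⟩ => by cases b <;> rfl
  simp [wordInv, List.map_reverse, Function.comp_def, this]

theorem inv_inv (u : F.Germ) : u.inv.inv = u := by
  obtain ⟨p, rfl⟩ := u.exists_mk_eq
  exact mk_congr rfl (wordInv_wordInv p.word)

theorem source_inv (u : F.Germ) : u.inv.source = u.target := by
  obtain ⟨p, rfl⟩ := u.exists_mk_eq
  rfl

theorem isLocalHomeomorph_target : IsLocalHomeomorph (target : F.Germ → F.Universal) := by
  let e : F.Germ ≃ₜ F.Germ := ⟨⟨inv, inv, inv_inv, inv_inv⟩, continuous_inv, continuous_inv⟩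
  convert isLocalHomeomorph_source.comp e.isLocalHomeomorph using 1
  exact funext fun u => u.source_inv.symm

/-- The groupoid model: the groupoid of germs of words in open slices. -/
noncomputable def _root_.GroupoidDiagram.modelGroupoid (F : GroupoidDiagram C) : EtaleGroupoid.{u} where
  Obj := F.Universal
  Arr := F.Germ
  r := target
  s := source
  unit ω := mk (.unit ω)
  inv := inv
  mul := mul
  r_unit _ := rfl
  s_unit _ := rfl
  r_inv u := by
    obtain ⟨p, rfl⟩ := u.exists_mk_eq
    rfl
  s_inv := source_inv
  r_mul u v e := by
    obtain ⟨p, rfl⟩ := u.exists_mk_eq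
    obtain ⟨q, rfl⟩ := v.exists_mk_eq
    rw [mul_mk _ _ e]
    rfl
  s_mul u v e := by
    obtain ⟨p, rfl⟩ := u.exists_mk_eq
    obtain ⟨q, rfl⟩ := v.exists_mk_eq
    rw [mul_mk _ _ e]
    rfl
  unit_mul u := by
    obtain ⟨p, rfl⟩ := u.exists_mk_eq
    rw [mul_mk _ _ rfl]
    exact mk_congr rfl (List.append_nil _)
  mul_unit u := by
    obtain ⟨p, rfl⟩ := u.exists_mk_eq
    rw [mul_mk _ _ rfl]
    exact mk_congr rfl (List.nil_append _)
  inv_mul u := by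
    obtain ⟨p, rfl⟩ := u.exists_mk_eq
    simp only [inv_mk]
    rw [mul_mk _ _ rfl]
    exact mk_eq_iff.2 ⟨rfl, .wordInv_append p.wordRel p.isOpenWord⟩
  mul_inv u := by
    obtain ⟨p, rfl⟩ := u.exists_mk_eq
    simp only [inv_mk]
    rw [mul_mk _ _ rfl]
    refine mk_eq_iff.2 ⟨rfl, ?_⟩
    have h := GermEq.wordInv_append p.inv.wordRel p.inv.isOpenWord
    rwa [show wordInv p.inv.word = p.word from wordInv_wordInv _] at h
  mul_assoc u v w e₁ e₂ := by
    obtain ⟨p, rfl⟩ := u.exists_mk_eq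
    obtain ⟨q, rfl⟩ := v.exists_mk_eq
    obtain ⟨r, rfl⟩ := w.exists_mk_eq
    simp only [mul_mk _ _ e₁, mul_mk _ _ e₂]
    rw [mul_mk (p.comp q e₁) _ e₂, mul_mk _ (q.comp r e₂) e₁]
    exact mk_congr rfl (List.append_assoc _ _ _).symm
  isLocalHomeomorph_r := isLocalHomeomorph_target
  isLocalHomeomorph_s := isLocalHomeomorph_source
  continuous_unit := continuous_of_ofWord continuous_id
    fun ω => ⟨[], .of_forall fun ω' => mk_mem_ofWord (.unit ω')⟩
  continuous_inv := continuous_inv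
  continuous_mul := by
    refine continuous_of_ofWord ?_ ?_
    · convert continuous_source.comp (continuous_snd.comp continuous_subtype_val) using 2 with p
      obtain ⟨⟨u, v⟩, e⟩ := p
      obtain ⟨p, rfl⟩ := u.exists_mk_eq
      obtain ⟨q, rfl⟩ := v.exists_mk_eq
      rw [mul_mk _ _ e]
      rfl
    · rintro ⟨⟨u, v⟩, e⟩
      obtain ⟨p, rfl⟩ := u.exists_mk_eq
      obtain ⟨q, rfl⟩ := v.exists_mk_eq
      refine ⟨q.word ++ p.word, ?_⟩
      filter_upwards [(continuous_fst.comp continuous_subtype_val).continuousAt.preimage_mem_nhds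
        ((isOpen_ofWord _).mem_nhds (mk_mem_ofWord p)),
        (continuous_snd.comp continuous_subtype_val).continuousAt.preimage_mem_nhds
        ((isOpen_ofWord _).mem_nhds (mk_mem_ofWord q))]
      rintro ⟨⟨u', v'⟩, e'⟩ ⟨p', hp, rfl : mk p' = u'⟩ ⟨q', hq, rfl : mk q' = v'⟩
      rw [mul_mk _ _ e']
      exact ⟨_, by rw [← hp, ← hq]; rfl, rfl⟩

end Germ
end GroupoidDiagram

theorem EtaleGroupoid.LeftAction.inv_act {G : EtaleGroupoid.{u}} {X : Type u} [TopologicalSpace X]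
    (A : G.LeftAction X) (g : G.Arr) (x : X) (e : G.s g = A.anchor x) :
    A.act (G.inv g) (A.act g x e) ((G.s_inv g).trans (A.anchor_act g x e).symm) = x := by
  rw [A.act_act _ _ _ (G.s_inv g) e,
    A.act_congr ((G.inv_mul g).trans (congrArg G.unit e)) rfl]
  exact A.unit_act x

/-- Reduces the proof that the two constructions are mutually inverse to equivariance of the
identity map; the analogue for `F`-actions follows below. -/
theorem EtaleGroupoid.LeftAction.eq_of_isEquivariant_id {G : EtaleGroupoid.{u}} {X : Type u}
    [TopologicalSpace X] {A A' : G.LeftAction X} (h : A.IsEquivariant A' id) : A = A' := by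
  obtain ⟨a, f, _, _, _, _, _⟩ := A
  obtain ⟨a', f', _, _, _, _, _⟩ := A'
  obtain ⟨h₁, h₂⟩ := h
  obtain rfl : a' = a := funext h₁
  obtain rfl : f = f' := funext fun g => funext fun x => funext fun e => h₂ g x e
  rfl

/-! ### From `F`-actions to actions of the groupoid of germs -/

namespace GroupoidDiagram

variable {C : Type u} [SmallCategory C] {F : GroupoidDiagram C}
variable {Y Y' : Type u} [TopologicalSpace Y] [TopologicalSpace Y']

theorem Action.eq_of_isEquivariant_id {A A' : F.Action Y} (h : A.IsEquivariant A' id) :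
    A = A' := by
  have hp : A'.piece = A.piece := funext fun x => Set.ext fun y => h.mem_piece_iff
  obtain ⟨h₁, h₂, h₃⟩ := h
  obtain ⟨p, a, f, _, _, _, _, _, _, _, _, _⟩ := A
  obtain ⟨p', a', f', _, _, _, _, _, _, _, _, _⟩ := A'
  obtain rfl : p' = p := hp
  obtain rfl : a' = a := funext fun x => funext fun y => h₂ x y
  obtain rfl : @f = @f' := by
    funext x x' g γ y e
    exact Subtype.ext (h₃ g γ y e)
  rfl

open Universal

namespace Action

variable (A : F.Action Y)

/-- Representatives of a germ act alike on `y` because germ equality is required in every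
`F`-action, in particular in `A`. -/
theorem exists_germ_act (u : F.Germ) (y : Y) (e : u.source = A.toUniversal y) :
    ∃ z, ∀ p : F.PointedWord, Germ.mk p = u → A.WordRel p.word y z := by
  obtain ⟨p, rfl⟩ := u.exists_mk_eq
  have h := p.wordRel
  rw [show p.source = A.toUniversal y from e] at h
  obtain ⟨z, hz, -⟩ := exists_wordRel h
  refine ⟨z, fun q hq => ?_⟩
  obtain ⟨h₁, h₂⟩ := Germ.mk_eq_iff.1 hq.symm
  exact (h₂.wordRel_iff e.symm).1 hz

/-- The action of germs of words on an `F`-action. -/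
noncomputable def germAct (u : F.Germ) (y : Y) (e : u.source = A.toUniversal y) : Y :=
  (A.exists_germ_act u y e).choose

variable {A}

theorem wordRel_germAct (p : F.PointedWord) (y : Y) (e : (Germ.mk p).source = A.toUniversal y) :
    A.WordRel p.word y (A.germAct (Germ.mk p) y e) :=
  (A.exists_germ_act _ y e).choose_spec p rfl

theorem germAct_eq {p : F.PointedWord} {y z : Y} {e : (Germ.mk p).source = A.toUniversal y}
    (h : A.WordRel p.word y z) : A.germAct (Germ.mk p) y e = z :=
  (wordRel_germAct p y e).right_unique h

theorem toUniversal_germAct (u : F.Germ) (y : Y) (e : u.source = A.toUniversal y) :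
    A.toUniversal (A.germAct u y e) = u.target := by
  obtain ⟨p, rfl⟩ := u.exists_mk_eq
  have h := wordRel_toUniversal (wordRel_germAct p y e)
  rw [← show p.source = A.toUniversal y from e] at h
  exact h.right_unique p.wordRel

theorem germAct_congr {u u' : F.Germ} (h : u = u') (y : Y) (e : u.source = A.toUniversal y) :
    A.germAct u y e = A.germAct u' y (h ▸ e) := by
  subst h; rfl

variable (A) in
theorem continuous_germAct : Continuous
    fun p : {p : F.Germ × Y // p.1.source = A.toUniversal p.2} => A.germAct p.1.1 p.1.2 p.2 := by
  refine continuous_def.2 fun W hW => isOpen_iff_forall_mem_open.2 ?_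
  rintro ⟨⟨u, y⟩, e⟩ h
  obtain ⟨p, rfl⟩ := u.exists_mk_eq
  refine ⟨{q | q.1.1 ∈ Germ.ofWord p.word ∧ ∃ z ∈ W, A.WordRel p.word q.1.2 z}, ?_, ?_,
    Germ.mk_mem_ofWord p, _, h, wordRel_germAct p y e⟩
  · rintro ⟨⟨u', y'⟩, e'⟩ ⟨⟨q, hq, rfl : Germ.mk q = u'⟩, z, hz, h'⟩
    have : A.germAct (Germ.mk q) y' e' = z := germAct_eq (hq ▸ h')
    rwa [mem_preimage, this]
  · exact ((Germ.isOpen_ofWord _).preimage (continuous_fst.comp continuous_subtype_val)).inter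
      ((isOpen_setOf_wordRel p.isOpenWord hW).preimage
        (continuous_snd.comp continuous_subtype_val))

variable (A) in
/-- The action of the groupoid model that corresponds to an `F`-action. -/
noncomputable def toModel : (modelGroupoid F).LeftAction Y where
  anchor := A.toUniversal
  act := A.germAct
  continuous_anchor := A.continuous_toUniversal
  continuous_act := A.continuous_germAct
  anchor_act := toUniversal_germAct
  unit_act y := germAct_eq (p := .unit _) rfl
  act_act u v y e₁ e₂ := by
    obtain ⟨p, rfl⟩ := u.exists_mk_eq
    obtain ⟨q, rfl⟩ := v.exists_mk_eq
    have h : (modelGroupoid F).mul (Germ.mk p) (Germ.mk q) e₁ = Germ.mk (p.comp q e₁) :=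
      Germ.mul_mk p q e₁
    obtain ⟨z, hz, hz'⟩ := wordRel_append.1 (wordRel_germAct (p.comp q e₁) y e₂)
    obtain rfl : A.germAct (Germ.mk q) y e₂ = z := germAct_eq hz
    exact (germAct_eq hz').trans (germAct_congr h.symm y _)

theorem IsEquivariant.toModel {A' : F.Action Y'} {φ : Y → Y'} (hφ : A.IsEquivariant A' φ) :
    A.toModel.IsEquivariant A'.toModel φ := by
  refine ⟨hφ.toUniversal_eq, fun u y e => ?_⟩
  obtain ⟨p, rfl⟩ := u.exists_mk_eq
  exact (germAct_eq (e := e.trans (hφ.toUniversal_eq y).symm)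
    (hφ.wordRel (wordRel_germAct p y e))).symm

end Action

/-! ### Germs of multiplication by elements of the correspondences -/

/-- The letter of a slice, acting by multiplication. -/
def sliceLetter {x x' : C} (g : x ⟶ x') (S : Set (F.corr g).Carrier) (hS : (F.corr g).IsSlice S) :
    F.Letter := ⟨g, S, hS, true⟩

theorem wordRel_sliceLetter {A : F.Action Y} {x x' : C} {g : x ⟶ x'} {S : Set (F.corr g).Carrier}
    {hS : (F.corr g).IsSlice S} {y z : Y} :
    A.WordRel [sliceLetter g S hS] y z ↔ A.SliceRel g S y z :=
  Action.wordRel_singleton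

theorem isOpenWord_sliceLetter {x x' : C} {g : x ⟶ x'} {S : Set (F.corr g).Carrier}
    {hS : (F.corr g).IsSlice S} (hSo : IsOpen S) : IsOpenWord [sliceLetter g S hS] := by
  rintro l hl
  obtain rfl := List.mem_singleton.1 hl
  exact hSo

theorem germEq_of_anchor {x : C} {ω : piece F x} {w w' : List F.Letter} {V : Set (F.gr x).Obj}
    (hV : IsOpen V) (hω : anchor x ω ∈ V)
    (h : ∀ (Y : Type u) [TopologicalSpace Y] (A : F.Action Y) (y : A.piece x), A.anchor x y ∈ V →
      ∀ z, A.WordRel w y z ↔ A.WordRel w' y z) : GermEq ω.1 w w' := by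
  refine ⟨_, (isOpen_piece x).isOpenMap_subtype_val _ (hV.preimage ((action F).continuous_anchor x)),
    ⟨ω, hω, rfl⟩, ?_⟩
  rintro Y _ A y ⟨⟨_, hω'⟩, hω'V, rfl⟩ z
  have hy := toUniversal_mem_piece_iff.1 hω'
  have : anchor x (ofPiece A ⟨y, hy⟩) ∈ V := hω'V
  rw [anchor_ofPiece] at this
  exact h Y A ⟨y, hy⟩ this z

theorem Universal.anchor_act {x x' : C} (g : x ⟶ x') (γ : (F.corr g).Carrier) (ω : piece F x)
    (e : (F.corr g).right.anchor γ = anchor x ω) :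
    anchor x' (act g γ ω e) = (F.corr g).left.anchor γ :=
  (action F).anchor_act g γ ω e

namespace PointedWord

/-- The pointed word of a slice that contains `γ`. -/
noncomputable def ofSlice {x x' : C} (g : x ⟶ x') (γ : (F.corr g).Carrier) (ω : piece F x)
    (e : (F.corr g).right.anchor γ = anchor x ω) (S : Set (F.corr g).Carrier)
    (hS : (F.corr g).IsSlice S) (hSo : IsOpen S) (hγ : γ ∈ S) : F.PointedWord where
  source := ω
  word := [sliceLetter g S hS]
  isOpenWord := isOpenWord_sliceLetter hSo
  target := act g γ ω e
  wordRel := wordRel_sliceLetter.2 ⟨γ, hγ, ω.2, e, rfl⟩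

end PointedWord

namespace Germ

/-- The germ of multiplication by `γ`. -/
noncomputable def ofMul {x x' : C} (g : x ⟶ x') (γ : (F.corr g).Carrier) (ω : piece F x)
    (e : (F.corr g).right.anchor γ = anchor x ω) : F.Germ :=
  let h := GroupoidCorrespondence.exists_isSlice γ
  mk (.ofSlice g γ ω e h.choose h.choose_spec.2.2 h.choose_spec.1 h.choose_spec.2.1)

/-- Over the open set of anchors of elements common to both slices, each slice contains just the
common element, so both act by the same multiplication. -/
theorem ofMul_eq {x x' : C} {g : x ⟶ x'} {γ : (F.corr g).Carrier} {ω : piece F x}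
    (e : (F.corr g).right.anchor γ = anchor x ω) {S : Set (F.corr g).Carrier}
    (hS : (F.corr g).IsSlice S) (hSo : IsOpen S) (hγ : γ ∈ S) :
    ofMul g γ ω e = mk (.ofSlice g γ ω e S hS hSo hγ) := by
  obtain ⟨hSo', hγ', hS'⟩ := (GroupoidCorrespondence.exists_isSlice γ).choose_spec
  refine mk_eq_iff.2 ⟨rfl, germEq_of_anchor ((F.corr g).isLocalHomeomorph_anchor.isOpenMap _
    (hSo'.inter hSo)) ⟨γ, ⟨hγ', hγ⟩, e⟩ ?_⟩
  rintro Y _ A y ⟨δ, ⟨hδ', hδ⟩, hy⟩ z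
  refine wordRel_sliceLetter.trans (Iff.trans ?_ wordRel_sliceLetter.symm)
  constructor
  · rintro ⟨γ', hγ', h⟩
    obtain rfl := hS'.1 hδ' hγ' (hy.trans h.2.1.symm)
    exact ⟨_, hδ, h⟩
  · rintro ⟨γ', hγ', h⟩
    obtain rfl := hS.1 hδ hγ' (hy.trans h.2.1.symm)
    exact ⟨_, hδ', h⟩

theorem source_ofMul {x x' : C} (g : x ⟶ x') (γ : (F.corr g).Carrier) (ω : piece F x)
    (e : (F.corr g).right.anchor γ = anchor x ω) : (ofMul g γ ω e).source = ω := rfl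

theorem target_ofMul {x x' : C} (g : x ⟶ x') (γ : (F.corr g).Carrier) (ω : piece F x)
    (e : (F.corr g).right.anchor γ = anchor x ω) : (ofMul g γ ω e).target = act g γ ω e := rfl

theorem ofMul_congr {x x' : C} {g : x ⟶ x'} {γ γ' : (F.corr g).Carrier} {ω ω' : piece F x}
    (hγ : γ = γ') (hω : ω = ω') (e : (F.corr g).right.anchor γ = anchor x ω) :
    ofMul g γ ω e = ofMul g γ' ω' (hγ ▸ hω ▸ e) := by
  subst hγ hω; rfl

/-- Take the anchors of those `δ₂ ∈ S₂` for which some `δ₁ ∈ S₁` is composable with `δ₂` and has `δ₁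
· δ₂ ∈ S`. These form an open set, and over it both words send `y` to `δ₁ · (δ₂ · y)`. -/
theorem mul_ofMul {x₀ x₁ x₂ : C} (g₁ : x₁ ⟶ x₀) (g₂ : x₂ ⟶ x₁) (k : x₂ ⟶ x₀)
    (hk : g₂ ≫ g₁ = k) (γ₁ : (F.corr g₁).Carrier) (γ₂ : (F.corr g₂).Carrier) (ω : piece F x₂)
    (e₁ : (F.corr g₁).right.anchor γ₁ = (F.corr g₂).left.anchor γ₂)
    (e₂ : (F.corr g₂).right.anchor γ₂ = anchor x₂ ω) :
    mul (ofMul g₁ γ₁ (act g₂ γ₂ ω e₂) (e₁.trans (Universal.anchor_act g₂ γ₂ ω e₂).symm))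
      (ofMul g₂ γ₂ ω e₂) rfl = ofMul k ((F.μ g₁ g₂ k hk).mul γ₁ γ₂ e₁) ω
        (((F.μ g₁ g₂ k hk).right_anchor γ₁ γ₂ e₁).trans e₂) := by
  obtain ⟨S₁, hS₁o, hγ₁, hS₁⟩ := GroupoidCorrespondence.exists_isSlice γ₁
  obtain ⟨S₂, hS₂o, hγ₂, hS₂⟩ := GroupoidCorrespondence.exists_isSlice γ₂
  obtain ⟨S, hSo, hγ, hS⟩ := GroupoidCorrespondence.exists_isSlice ((F.μ g₁ g₂ k hk).mul γ₁ γ₂ e₁)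
  refine Eq.trans ?_ (ofMul_eq (γ := (F.μ g₁ g₂ k hk).mul γ₁ γ₂ e₁) _ hS hSo hγ).symm
  simp only [ofMul_eq _ hS₁ hS₁o hγ₁, ofMul_eq _ hS₂ hS₂o hγ₂]
  rw [mul_mk _ _ rfl]
  refine mk_eq_iff.2 ⟨rfl, germEq_of_anchor ((F.corr g₂).isLocalHomeomorph_anchor.isOpenMap _
    (isOpen_setOf_exists_fibreProd (F.corr g₁).isLocalHomeomorph_anchor.isOpenMap
      (F.corr g₂).left.continuous_anchor
      (T := {p | (p.1.1 ∈ S₁ ∧ p.1.2 ∈ S₂) ∧ (F.μ g₁ g₂ k hk).mul p.1.1 p.1.2 p.2 ∈ S})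
      (((hS₁o.preimage (continuous_fst.comp continuous_subtype_val)).inter
        (hS₂o.preimage (continuous_snd.comp continuous_subtype_val))).inter
          (hSo.preimage (F.μ g₁ g₂ k hk).continuous_mul))))
    ⟨γ₂, ⟨γ₁, e₁, ⟨hγ₁, hγ₂⟩, hγ⟩, e₂⟩ ?_⟩
  rintro Y _ A y ⟨δ₂, ⟨δ₁, e, ⟨hδ₁, hδ₂⟩, hδ⟩, hy⟩ z
  change A.WordRel ([sliceLetter g₂ S₂ hS₂] ++ [sliceLetter g₁ S₁ hS₁]) y z ↔
    A.WordRel [sliceLetter k S hS] y z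
  rw [Action.wordRel_append]
  simp only [wordRel_sliceLetter]
  have h₂ : A.MulRel g₂ δ₂ y (A.act g₂ δ₂ y hy) := ⟨y.2, hy, rfl⟩
  have h₁ : A.MulRel g₁ δ₁ (A.act g₂ δ₂ y hy)
      (A.act g₁ δ₁ (A.act g₂ δ₂ y hy) (e.trans (A.anchor_act _ _ _ _).symm)) :=
    ⟨Subtype.coe_prop _, _, rfl⟩
  have h := h₂.comp hk e h₁
  constructor
  · rintro ⟨v, hv, hz⟩
    obtain rfl := hv.right_unique hS₂ ⟨δ₂, hδ₂, h₂⟩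
    obtain rfl := hz.right_unique hS₁ ⟨δ₁, hδ₁, h₁⟩
    exact ⟨_, hδ, h⟩
  · intro hz
    obtain rfl := hz.right_unique hS ⟨_, hδ, h⟩
    exact ⟨_, ⟨δ₂, hδ₂, h₂⟩, _, hδ₁, h₁⟩

end Germ
end GroupoidDiagram

/-! ### From actions of the groupoid of germs to `F`-actions -/

namespace GroupoidDiagram

variable {C : Type u} [SmallCategory C] {F : GroupoidDiagram C}
variable {Y Y' : Type u} [TopologicalSpace Y] [TopologicalSpace Y']

open Universal

section ModelAction

variable (B : (modelGroupoid F).LeftAction Y)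

/-- The anchor map of an action of the groupoid model. -/
def modelAnchor : Y → F.Universal := B.anchor

/-- The multiplication map of an action of the groupoid model. -/
def modelAct (u : F.Germ) (y : Y) (e : u.source = modelAnchor B y) : Y := B.act u y e

theorem continuous_modelAnchor : Continuous (modelAnchor B) := B.continuous_anchor

theorem continuous_modelAct : Continuous
    fun p : {p : F.Germ × Y // p.1.source = modelAnchor B p.2} => modelAct B p.1.1 p.1.2 p.2 :=
  B.continuous_act

variable {B}

theorem modelAnchor_modelAct (u : F.Germ) (y : Y) (e : u.source = modelAnchor B y) :
    modelAnchor B (modelAct B u y e) = u.target := B.anchor_act u y e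

theorem modelAct_modelAct (u v : F.Germ) (y : Y) (e₁ : u.source = v.target)
    (e₂ : v.source = modelAnchor B y) :
    modelAct B u (modelAct B v y e₂) (e₁.trans (modelAnchor_modelAct v y e₂).symm) =
      modelAct B (u.mul v e₁) y (((modelGroupoid F).s_mul u v e₁).trans e₂) :=
  B.act_act u v y e₁ e₂

theorem modelAct_congr {u u' : F.Germ} {y y' : Y} (hu : u = u') (hy : y = y')
    (e : u.source = modelAnchor B y) : modelAct B u y e = modelAct B u' y' (hu ▸ hy ▸ e) := by
  subst hu hy; rfl

theorem modelAct_unit {y : Y} {p : F.PointedWord} (e : p.source = modelAnchor B y)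
    (hp : p.word = []) : modelAct B (Germ.mk p) y e = y :=
  (modelAct_congr (Germ.mk_congr (q := .unit _) e hp) rfl e).trans (B.unit_act y)

theorem inv_modelAct (u : F.Germ) (y : Y) (e : u.source = modelAnchor B y) :
    modelAct B u.inv (modelAct B u y e) (u.source_inv.trans (modelAnchor_modelAct u y e).symm) =
      y :=
  B.inv_act u y e

theorem modelAct_inv (u : F.Germ) (y : Y) (e : u.target = modelAnchor B y) :
    modelAct B u (modelAct B u.inv y (u.source_inv.trans e))
      (((modelGroupoid F).r_inv u).symm.trans (modelAnchor_modelAct _ _ _).symm) = y :=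
  (modelAct_congr u.inv_inv.symm rfl _).trans (inv_modelAct u.inv y _)

theorem modelAct_injective {u : F.Germ} {y y' : Y} {e : u.source = modelAnchor B y}
    {e' : u.source = modelAnchor B y'} (h : modelAct B u y e = modelAct B u y' e') : y = y' := by
  rw [← inv_modelAct u y e, ← inv_modelAct u y' e']
  exact modelAct_congr rfl h _

variable (B) in
/-- The graph of the partial bijection by which the germs of a word act. -/
def ModelRel (w : List F.Letter) (y z : Y) : Prop :=
  ∃ p : F.PointedWord, p.word = w ∧ ∃ e : p.source = modelAnchor B y,
    modelAct B (Germ.mk p) y e = z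

theorem ModelRel.inv {w : List F.Letter} {y z : Y} (h : ModelRel B w y z) :
    ModelRel B (wordInv w) z y := by
  obtain ⟨p, rfl, e, rfl⟩ := h
  exact ⟨p.inv, rfl, (modelAnchor_modelAct (Germ.mk p) y e).symm, inv_modelAct (Germ.mk p) y e⟩

theorem modelRel_inv {w : List F.Letter} {y z : Y} :
    ModelRel B (wordInv w) y z ↔ ModelRel B w z y :=
  ⟨fun h => by simpa only [Germ.wordInv_wordInv] using h.inv, ModelRel.inv⟩

/-- On the open set `D` of points whose anchor is in the domain of `w`, the germ of `w` at the
anchor is unique and varies continuously, so acting by it is continuous on `D`. -/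
theorem isOpen_setOf_modelRel (w : List F.Letter) {W : Set Y} (hW : IsOpen W) :
    IsOpen {y | ∃ z ∈ W, ModelRel B w y z} := by
  let D : Set Y := modelAnchor B ⁻¹' (Germ.source '' Germ.ofWord w)
  have hD : IsOpen D :=
    (Germ.isOpenMap_source _ (Germ.isOpen_ofWord w)).preimage (continuous_modelAnchor B)
  choose f hfw hf using fun y : D => y.2
  have hfc : Continuous f := Germ.continuous_of_ofWord
    (((continuous_modelAnchor B).comp continuous_subtype_val).congr fun y => (hf y).symm)
    fun y => ⟨w, .of_forall hfw⟩
  have hc : Continuous fun y : D => modelAct B (f y) y (hf y) :=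
    (continuous_modelAct B).comp ((hfc.prodMk continuous_subtype_val).subtype_mk hf)
  convert hD.isOpenMap_subtype_val _ (hW.preimage hc) using 1
  ext y
  constructor
  · rintro ⟨_, hz, p, hp, e, rfl⟩
    have hy : y ∈ D := ⟨_, ⟨p, hp, rfl⟩, e⟩
    refine ⟨⟨y, hy⟩, ?_, rfl⟩
    have : Germ.mk p = f ⟨y, hy⟩ :=
      Germ.injOn_source_ofWord w ⟨p, hp, rfl⟩ (hfw _) (e.trans (hf ⟨y, hy⟩).symm)
    rwa [mem_preimage, ← modelAct_congr this rfl e]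
  · rintro ⟨y, hy, rfl⟩
    obtain ⟨p, hp, h⟩ := hfw y
    exact ⟨_, hy, p, hp, (congrArg Germ.source h).trans (hf y), modelAct_congr h rfl _⟩

theorem modelRel_sliceLetter {x x' : C} {g : x ⟶ x'} {S : Set (F.corr g).Carrier}
    {hS : (F.corr g).IsSlice S} (hSo : IsOpen S) {y z : Y} :
    ModelRel B [sliceLetter g S hS] y z ↔ ∃ γ ∈ S, ∃ (hy : modelAnchor B y ∈ piece F x)
      (e : (F.corr g).right.anchor γ = anchor x ⟨_, hy⟩),
        modelAct B (Germ.ofMul g γ ⟨_, hy⟩ e) y rfl = z := by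
  constructor
  · rintro ⟨p, hp, e, rfl⟩
    have h := p.wordRel
    rw [hp, wordRel_sliceLetter, e] at h
    obtain ⟨γ, hγ, hy, e', -⟩ := h
    exact ⟨γ, hγ, hy, e', modelAct_congr
      ((Germ.ofMul_eq (ω := ⟨_, hy⟩) e' hS hSo hγ).trans (Germ.mk_congr e.symm hp.symm)) rfl _⟩
  · rintro ⟨γ, hγ, hy, e, rfl⟩
    exact ⟨_, rfl, rfl, modelAct_congr (Germ.ofMul_eq e hS hSo hγ).symm rfl _⟩

variable (B)

/-- The anchor map of the underlying `F`-action, on a piece. -/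
abbrev modelPoint {x : C} (y : modelAnchor B ⁻¹' piece F x) : piece F x := ⟨modelAnchor B y, y.2⟩

/-- The multiplication maps of the underlying `F`-action. -/
noncomputable def modelMul {x x' : C} (g : x ⟶ x') (γ : (F.corr g).Carrier)
    (y : modelAnchor B ⁻¹' piece F x)
    (e : (F.corr g).right.anchor γ = anchor x (modelPoint B y)) : modelAnchor B ⁻¹' piece F x' :=
  ⟨modelAct B (Germ.ofMul g γ (modelPoint B y) e) y (Germ.source_ofMul g γ _ e), by
    rw [mem_preimage, modelAnchor_modelAct, Germ.target_ofMul]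
    exact Subtype.coe_prop _⟩

variable {B}

theorem modelPoint_modelMul {x x' : C} (g : x ⟶ x') (γ : (F.corr g).Carrier)
    (y : modelAnchor B ⁻¹' piece F x)
    (e : (F.corr g).right.anchor γ = anchor x (modelPoint B y)) :
    modelPoint B (modelMul B g γ y e) = act g γ (modelPoint B y) e :=
  Subtype.ext (modelAnchor_modelAct _ _ _)

theorem modelMul_modelMul {x₀ x₁ x₂ : C} (g₁ : x₁ ⟶ x₀) (g₂ : x₂ ⟶ x₁) (k : x₂ ⟶ x₀)
    (hk : g₂ ≫ g₁ = k) (γ₁ : (F.corr g₁).Carrier) (γ₂ : (F.corr g₂).Carrier)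
    (y : modelAnchor B ⁻¹' piece F x₂)
    (e₁ : (F.corr g₁).right.anchor γ₁ = (F.corr g₂).left.anchor γ₂)
    (e₂ : (F.corr g₂).right.anchor γ₂ = anchor x₂ (modelPoint B y))
    (e : (F.corr g₁).right.anchor γ₁ = anchor x₁ (modelPoint B (modelMul B g₂ γ₂ y e₂))) :
    modelMul B g₁ γ₁ (modelMul B g₂ γ₂ y e₂) e =
      modelMul B k ((F.μ g₁ g₂ k hk).mul γ₁ γ₂ e₁) y
        (((F.μ g₁ g₂ k hk).right_anchor γ₁ γ₂ e₁).trans e₂) := by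
  refine Subtype.ext ?_
  refine (modelAct_congr (Germ.ofMul_congr rfl (modelPoint_modelMul g₂ γ₂ y e₂) _) rfl _).trans ?_
  refine (modelAct_modelAct (B := B) _ (Germ.ofMul g₂ γ₂ (modelPoint B y) e₂) (y : Y) rfl rfl).trans ?_
  exact modelAct_congr (Germ.mul_ofMul g₁ g₂ k hk γ₁ γ₂ _ e₁ e₂) rfl _

theorem modelMul_congr {x x' : C} {g : x ⟶ x'} {γ γ' : (F.corr g).Carrier}
    {y y' : modelAnchor B ⁻¹' piece F x} (hγ : γ = γ') (hy : y = y')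
    (e : (F.corr g).right.anchor γ = anchor x (modelPoint B y)) :
    modelMul B g γ y e = modelMul B g γ' y' (hγ ▸ hy ▸ e) := by
  subst hγ hy; rfl

theorem modelMul_injective {x x' : C} {g : x ⟶ x'} {γ : (F.corr g).Carrier}
    {y y' : modelAnchor B ⁻¹' piece F x} (hy : modelPoint B y = modelPoint B y')
    {e : (F.corr g).right.anchor γ = anchor x (modelPoint B y)}
    {e' : (F.corr g).right.anchor γ = anchor x (modelPoint B y')}
    (h : modelMul B g γ y e = modelMul B g γ y' e') : y = y' :=
  Subtype.ext (modelAct_injective ((congrArg Subtype.val h).trans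
    (modelAct_congr (Germ.ofMul_congr rfl hy.symm _) rfl _)))

variable (B) in
/-- The `F`-action that corresponds to an action of the groupoid model. -/
noncomputable def ofModel : F.Action Y where
  piece x := modelAnchor B ⁻¹' piece F x
  anchor x y := anchor x (modelPoint B y)
  act := modelMul B
  isClopen_piece x := ((action F).isClopen_piece x).preimage (continuous_modelAnchor B)
  existsUnique_piece y := (action F).existsUnique_piece _
  continuous_anchor x := ((action F).continuous_anchor x).comp
    (((continuous_modelAnchor B).comp continuous_subtype_val).subtype_mk _)
  continuous_act {x x'} g := by
    refine GroupoidCorrespondence.continuous_of_isSlice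
      (r := fun y => anchor x (modelPoint B y)) fun S hSo hS W hW => ?_
    obtain ⟨O, hO, rfl⟩ := isOpen_induced_iff.1 hW
    convert (isOpen_setOf_modelRel (B := B) [sliceLetter g S hS] hO).preimage
      (continuous_subtype_val (p := (· ∈ modelAnchor B ⁻¹' piece F x))) using 1
    ext y
    constructor
    · rintro ⟨γ, hγ, e, h⟩
      exact ⟨_, h, (modelRel_sliceLetter hSo).2 ⟨γ, hγ, y.2, e, rfl⟩⟩
    · rintro ⟨z, hz, h⟩
      obtain ⟨γ, hγ, hy, e, rfl⟩ := (modelRel_sliceLetter hSo).1 h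
      exact ⟨γ, hγ, e, hz⟩
  isOpenMap_act {x x'} g := by
    refine GroupoidCorrespondence.isOpenMap_of_isSlice
      (r := fun y => anchor x (modelPoint B y)) fun S hSo hS V hV => ?_
    obtain ⟨O, hO, rfl⟩ := isOpen_induced_iff.1 hV
    -- The image under a slice is the set where the inverse word takes values in `O`.
    convert (isOpen_setOf_modelRel (B := B) (wordInv [sliceLetter g S hS]) hO).preimage
      (continuous_subtype_val (p := (· ∈ modelAnchor B ⁻¹' piece F x'))) using 1
    ext z
    constructor
    · rintro ⟨γ, hγ, y, hy, e, rfl⟩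
      exact ⟨y, hy, modelRel_inv.2 ((modelRel_sliceLetter hSo).2 ⟨γ, hγ, y.2, e, rfl⟩)⟩
    · rintro ⟨y, hy, h⟩
      obtain ⟨γ, hγ, hy', e, h⟩ := (modelRel_sliceLetter hSo).1 (modelRel_inv.1 h)
      exact ⟨γ, hγ, ⟨y, hy'⟩, hy, e, Subtype.ext h⟩
  surjective_act {x x'} g z := by
    -- The equation is solved for the anchor in the universal action; the inverse germ then moves
    -- `z` to a solution in `Y`.
    obtain ⟨⟨⟨γ, ω⟩, e⟩, h⟩ := (action F).surjective_act g (modelPoint B z)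
    let u := Germ.ofMul g γ ω e
    have hu : u.target = modelAnchor B z := congrArg Subtype.val h
    let y := modelAct B u.inv z (u.source_inv.trans hu)
    have hy : modelAnchor B y = ω :=
      (modelAnchor_modelAct _ _ _).trans ((modelGroupoid F).r_inv u)
    have hyx : modelAnchor B y ∈ piece F x := hy ▸ ω.2
    have hω : ω = modelPoint B ⟨y, hyx⟩ := Subtype.ext hy.symm
    refine ⟨⟨(γ, ⟨y, hyx⟩), e.trans (congrArg (anchor x) hω)⟩, Subtype.ext ?_⟩
    exact (modelAct_congr (B := B) (Germ.ofMul_congr rfl hω e).symm rfl _).trans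
      (modelAct_inv (B := B) u z hu)
  anchor_act g γ y e := by
    rw [modelPoint_modelMul, Universal.anchor_act]
  act_act g₁ g₂ γ₁ γ₂ y e₁ e₂ := modelMul_modelMul g₁ g₂ _ rfl γ₁ γ₂ y e₁ e₂ _
  exists_of_act_eq {x x'} g γ γ' y y' e e' h := by
    have h' := congrArg (modelPoint B) h
    rw [modelPoint_modelMul, modelPoint_modelMul] at h'
    -- The universal action supplies `η` with `γ' = γ · η`. Then `γ · y = γ · (η · y')`, where `y`
    -- and `η · y'` have the same anchor, so the same germ acts on both and can be cancelled.
    obtain ⟨η, h₁, h₂, rfl, h₃⟩ := (action F).exists_of_act_eq g γ γ' _ _ e e' h'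
    refine ⟨η, h₁, h₂, rfl, ?_⟩
    have hη := ((F.unitIso x).right_anchor η).trans h₂
    have h₄ : modelPoint B y = modelPoint B (modelMul B (𝟙 x) ((F.unitIso x).homeo η) y' hη) :=
      h₃.trans (modelPoint_modelMul _ _ _ _).symm
    refine modelMul_injective h₄ (e' := e.trans (congrArg (anchor x) h₄)) (h.trans ?_)
    refine Eq.trans ?_ (modelMul_modelMul g (𝟙 x) g (Category.id_comp g) γ
      ((F.unitIso x).homeo η) y' (h₁.trans ((F.unitIso x).left_anchor η).symm) hη _).symm
    exact modelMul_congr (F.μ_unit_right g γ η h₁).symm rfl _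

theorem isEquivariant_modelAnchor : (ofModel B).IsEquivariant (action F) (modelAnchor B) :=
  ⟨fun _ y => y.2, fun _ _ => rfl, fun g γ y e =>
    congrArg Subtype.val (modelPoint_modelMul g γ y e)⟩

/-- The anchor map of `B` is equivariant to the universal action, so uniqueness identifies it with
the canonical map. -/
theorem toUniversal_ofModel (y : Y) : (ofModel B).toUniversal y = modelAnchor B y :=
  (eq_toUniversal isEquivariant_modelAnchor y).symm

theorem modelRel_of_letterRel {l : F.Letter} (hl : IsOpen l.slice) {y z : Y}
    (h : (ofModel B).LetterRel l y z) : ModelRel B [l] y z := by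
  obtain ⟨g, S, hS, _ | _⟩ := l
  · obtain ⟨γ, hγ, hy, e, h⟩ := h
    exact modelRel_inv.2 ((modelRel_sliceLetter (hS := hS) hl).2 ⟨γ, hγ, hy, e, h⟩)
  · obtain ⟨γ, hγ, hy, e, h⟩ := h
    exact (modelRel_sliceLetter hl).2 ⟨γ, hγ, hy, e, h⟩

theorem ModelRel.append {w w' : List F.Letter} {x y z : Y} (h : ModelRel B w x y)
    (h' : ModelRel B w' y z) : ModelRel B (w ++ w') x z := by
  obtain ⟨p, rfl, e, rfl⟩ := h
  obtain ⟨q, rfl, e', rfl⟩ := h'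
  have hqp : q.source = p.target := e'.trans (modelAnchor_modelAct _ _ _)
  refine ⟨q.comp p hqp, rfl, e, ?_⟩
  exact (modelAct_congr (Germ.mul_mk q p hqp).symm rfl e).trans
    (modelAct_modelAct (Germ.mk q) (Germ.mk p) x hqp e).symm

/-- Letters act by the germs of their slices by construction, and germs of concatenated words are
products. -/
theorem modelRel_of_wordRel {w : List F.Letter} (hw : IsOpenWord w) {y z : Y}
    (h : (ofModel B).WordRel w y z) : ModelRel B w y z := by
  induction w generalizing y with
  | nil =>
    obtain rfl : y = z := h
    exact ⟨.unit (modelAnchor B y), rfl, rfl, modelAct_unit _ rfl⟩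
  | cons l w ih =>
    obtain ⟨v, hv, h⟩ := h
    exact (modelRel_of_letterRel (hw l (by simp)) hv).append
      (ih (fun l' hl' => hw l' (List.mem_cons_of_mem _ hl')) h)

theorem toModel_ofModel : (ofModel B).toModel = B := by
  refine EtaleGroupoid.LeftAction.eq_of_isEquivariant_id
    ⟨fun y => (toUniversal_ofModel y).symm, fun u y e => ?_⟩
  obtain ⟨p, rfl⟩ := Germ.exists_mk_eq u
  obtain ⟨q, hq, e', h⟩ := modelRel_of_wordRel p.isOpenWord (Action.wordRel_germAct p y e)
  have he : p.source = modelAnchor B y := e.trans (toUniversal_ofModel y)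
  exact h.symm.trans (modelAct_congr (Germ.mk_congr (e'.trans he.symm) hq) rfl e')

theorem isEquivariant_ofModel {B' : (modelGroupoid F).LeftAction Y'} {φ : Y → Y'}
    (hφ : B.IsEquivariant B' φ) : (ofModel B).IsEquivariant (ofModel B') φ := by
  obtain ⟨h₁, h₂⟩ := hφ
  have hp : ∀ x (y : (ofModel B).piece x), φ y ∈ (ofModel B').piece x := fun x y => by
    change modelAnchor B' (φ y) ∈ piece F x
    rw [show modelAnchor B' (φ y) = modelAnchor B y from h₁ y]
    exact y.2
  have hpt : ∀ x (y : (ofModel B).piece x), modelPoint B' ⟨φ y, hp x y⟩ = modelPoint B y :=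
    fun x y => Subtype.ext (h₁ y)
  refine ⟨hp, fun x y => congrArg (anchor x) (hpt x y), fun {x x'} g γ y e => ?_⟩
  exact (h₂ _ _ _).trans (modelAct_congr (Germ.ofMul_congr rfl (hpt x y).symm e) rfl _)

end ModelAction

/-! ### The bijection and its naturality -/

theorem Action.ofModel_toModel (A : F.Action Y) : ofModel A.toModel = A := by
  refine (Action.eq_of_isEquivariant_id ⟨fun x y => toUniversal_mem_piece_iff.2 y.2,
    fun x y => anchor_ofPiece A y, fun {x x'} g γ y e => ?_⟩).symm
  obtain ⟨S, hSo, hγ, hS⟩ := GroupoidCorrespondence.exists_isSlice γ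
  have e' : (F.corr g).right.anchor γ = Universal.anchor x (ofPiece A y) :=
    e.trans (anchor_ofPiece A y).symm
  have h : A.germAct (Germ.mk (.ofSlice g γ (ofPiece A y) e' S hS hSo hγ)) y rfl = A.act g γ y e :=
    Action.germAct_eq (wordRel_sliceLetter.2 ⟨γ, hγ, y.2, e, rfl⟩)
  exact h.symm.trans (Action.germAct_congr (Germ.ofMul_eq e' hS hSo hγ).symm (y : Y) _)

/-- The groupoid of germs is a groupoid model. -/
noncomputable def groupoidModel (F : GroupoidDiagram C) : F.GroupoidModel where
  gpd := modelGroupoid F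
  equiv _ _ :=
    { toFun := ofModel
      invFun := Action.toModel
      left_inv := fun _ => toModel_ofModel
      right_inv := Action.ofModel_toModel }
  natural Y Y' _ _ B B' φ := by
    -- Each construction preserves equivariance, and since they are mutually inverse each also
    -- reflects it.
    refine ⟨isEquivariant_ofModel, fun h => ?_⟩
    have := Action.IsEquivariant.toModel h
    rwa [Equiv.coe_fn_mk, toModel_ofModel, Equiv.coe_fn_mk, toModel_ofModel] at this

end GroupoidDiagram

theorem mainTheorem1 {C : Type u} [SmallCategory C] (F : GroupoidDiagram C) :
    (∃ (Ω : Type u) (_ : TopologicalSpace Ω) (A : F.Action Ω), A.IsUniversal) ∧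
      Nonempty F.GroupoidModel :=
  ⟨⟨F.Universal, _, GroupoidDiagram.Universal.action F, GroupoidDiagram.Universal.isUniversal⟩,
    ⟨F.groupoidModel⟩⟩
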